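/- All graphs are finite and simple. Let $t,k\ge 3$ be integers and let $\mathcal T_k$ be the family of all trees on $k$ vertices. A critical coloring of a graph $G$ is a coloring of $E(G)$ with red and blue such that the red spanning subgraph $G_r$ contains no $K_t$ and the blue spanning subgraph $G_b$ contains no member of $\mathcal T_k$. A non-complete graph $G$ is $(K_t,\mathcal T_k)$-co-critical if $G$ has a critical coloring, but for every pair of distinct non-adjacent vertices $u,v$ the graph $G+uv$ has none. Theorem. There are constants $c(q,k)$, depending only on $q$ and $k$, such that the following holds for all integers $t,k\ge 3$. Let $G$ be a $(K_t,\mathcal T_k)$-co-critical graph on $n$ vertices, and let $\tau$ be a critical coloring of $G$ with the maximum number of red edges among all critical colorings of $G$. Let $D_1,\dots,D_p$ be the components of $G_b$ (including one-vertex components), and let $H$ be the spanning subgraph of $G$ obtained by deleting all edges of $G$ with both ends in the same $V(D_i)$, i.e. $H=G\setminus\bigcup_{i=1}^p E(G[V(D_i)])$. Then: (a) $\Delta(G_r)\le n-2$ and $\delta(G_r)\ge 2(t-2)$. (b) If $i\ne j$, $u\in V(D_i)$, $v\in V(D_j)$ and $uv\notin E(H)$, then $H[N_H(u)\cap N_H(v)]$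 contains a $K_{t-2}$ subgraph. (c) Let $uv\in E(H)$ be such that $v$ is contained in all $K_{t-2}$ subgraphs of $H[N_H(u)]$ and $\{v\}=V(D_j)$ for some $j$. Then $|D_i|=k-1$ for every $i$ with $u\notin V(D_i)$ and $V(D_i)\setminus N_H(u)\neq\emptyset$. (d) If $\delta(H)\le 2t-5$ and $k\ge t$, then for every vertex $u$ with $d_H(u)=\delta(H)$, no edge of $H[N_H(u)]$ is contained in all $K_{t-2}$ subgraphs of $H[N_H(u)]$. (e) $k\ge 2t-1-\delta(H)$ and $\delta(H)\ge t-1$. (f) $$\sum_{i=1}^p e(G[V(D_i)])\ \ge\ \left(\frac12\left\lceil\frac k2\right\rceil-\frac12\right)\left(n-(t-1)\left(\left\lceil\frac k2\right\rceil-1\right)\right),$$ and the inequality is strict if $k\ge 4$. (g) $H$ is connected. (h) For every integer $q\ge t-1$, if $\delta(H)\ge q$, then $e(H)\ge qn-c(q,k)$. -/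

import Mathlib

namespace CoCritical

/-- The two colors. -/
inductive Color
  | red
  | blue

open SimpleGraph

variable {V : Type*}

/-- The spanning subgraph of `G` formed by the red edges. -/
def redGraph {G : SimpleGraph V} (τ : G.EdgeLabeling Color) : SimpleGraph V :=
  τ.labelGraph Color.red

/-- The spanning subgraph of `G` formed by the blue edges. -/
def blueGraph {G : SimpleGraph V} (τ : G.EdgeLabeling Color) : SimpleGraph V :=
  τ.labelGraph Color.blue

/-- `G` contains no tree on `k` vertices as a (not necessarily induced) subgraph. -/
def TreeFree (k : ℕ) (G : SimpleGraph V) : Prop :=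
  ∀ T : SimpleGraph (Fin k), T.IsTree → T.Free G

/-- Every red/blue coloring of the edges of `G` has a red `K_t` or a blue tree on `k` vertices. -/
def Arrows (t k : ℕ) (G : SimpleGraph V) : Prop :=
  ∀ τ : G.EdgeLabeling Color, ¬ (redGraph τ).CliqueFree t ∨ ¬ TreeFree k (blueGraph τ)

/-- `G` is `(K_t, 𝒯_k)`-co-critical: it is not complete, it does not arrow `(K_t, 𝒯_k)`, but
adding any missing edge gives a graph that does. -/
def IsCoCritical (t k : ℕ) (G : SimpleGraph V) : Prop :=
  G ≠ ⊤ ∧ ¬ Arrows t k G ∧ ∀ u v : V, u ≠ v → ¬ G.Adj u v → Arrows t k (G ⊔ edge u v)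

/-- A critical coloring has no red `K_t` and no blue tree on `k` vertices. -/
def IsCriticalColoring (t k : ℕ) {G : SimpleGraph V} (τ : G.EdgeLabeling Color) : Prop :=
  (redGraph τ).CliqueFree t ∧ TreeFree k (blueGraph τ)

/-- A critical coloring with the largest number of red edges among all critical colorings. -/
def IsMaxRedCriticalColoring (t k : ℕ) {G : SimpleGraph V} (τ : G.EdgeLabeling Color) : Prop :=
  IsCriticalColoring t k τ ∧ ∀ σ : G.EdgeLabeling Color, IsCriticalColoring t k σ →
    (redGraph σ).edgeSet.ncard ≤ (redGraph τ).edgeSet.ncard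

/-- The spanning subgraph `H` of `G` obtained by deleting every edge of `G` (red or blue) that has
both ends in one component of the blue graph. -/
def crossGraph {G : SimpleGraph V} (τ : G.EdgeLabeling Color) : SimpleGraph V :=
  G.deleteEdges {e | ∃ D : (blueGraph τ).ConnectedComponent, ∀ x ∈ e, x ∈ D.supp}

end CoCritical

/-! Everything rests on recoloring. If every edge of `G` plus a missing edge `uv` is either in a
`K_t`-free graph or inside a class of a partition with classes smaller than `k`, then coloring the
first kind red and the rest blue is critical, which is impossible
(`IsCoCritical.false_of_partition`). The blue components have fewer than `k` vertices, and `H`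
together with them covers `G`. Varying this pair gives the structure: components are cliques of `G`;
a missing cross edge creates a `K_t` in `H`, which is (b); two components of total size below `k`
are completely joined in `H`; and if all `K_t`'s created by a missing cross edge share an edge `pq`,
the components of `p` and `q` have at least `k` vertices together (`le_add_of_forall_mem`). The last
fact yields (c) and (d).

Maximality of the red graph makes it `K_t`-saturated, and recoloring shows that no vertex is red to
all others. Hajnal's theorem then gives red minimum degree at least `2(t-2)`, hence (a) and the
bound on `k` in (e). If `δ(H) ≤ t-2`, the neighborhood of a vertex of minimum degree is a single
`K_{t-2}`, against (d); for `t = 3` it has no edge, and `degree_ne_one_of_eq_three` replaces (d).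
This proves the rest of (e), and (g) follows from it and (b).

For (f), components smaller than `⌈k/2⌉` are pairwise completely joined, so there are at most `t-1`
of them, and the rest is convexity. Part (h) adapts Day's theorem: a dense set is enlarged in `q`
rounds until the vertices outside it carry enough edges. A skew set-pair bound limits the cost of
each round independently of `n` and `t`. -/

namespace CoCritical

open SimpleGraph
-- Colorings from partitions, and the data of a maximal coloring
section

variable {V : Type*}

/-- A finite connected graph on at least `k` vertices contains a tree on `k` vertices. -/
theorem exists_isTree_isContained_of_connected {k : ℕ} (hk : 1 ≤ k) (m : ℕ) :
    ∀ {W : Type*} [Fintype W] (G : SimpleGraph W), Fintype.card W = k + m → G.Connected →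
      ∃ T : SimpleGraph (Fin k), T.IsTree ∧ T ⊑ G := by
  classical
  induction m with
  | zero =>
    intro W _ G hW hG
    obtain ⟨T, hTG, hT⟩ := hG.exists_isTree_le
    refine ⟨T.overFin hW, (T.overFinIso hW).isTree_iff.1 hT, ?_⟩
    exact (T.overFinIso hW).isContained'.trans (IsContained.of_le hTG)
  | succ m ih =>
    intro W _ G hW hG
    have : Nontrivial W := Fintype.one_lt_card_iff_nontrivial.1 (by omega)
    obtain ⟨v, hv⟩ := hG.exists_connected_induce_compl_singleton_of_finite_nontrivial
    obtain ⟨T, hT, hTG⟩ := ih (G.induce {v}ᶜ) (by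
      rw [Fintype.card_compl_set, hW, Set.card_singleton]; omega) hv
    exact ⟨T, hT, hTG.trans (Embedding.induce _).isContained⟩

theorem TreeFree.ncard_supp_lt [Finite V] {k : ℕ} (hk : 1 ≤ k) {B : SimpleGraph V}
    (hB : TreeFree k B) (D : B.ConnectedComponent) : D.supp.ncard < k := by
  classical
  have := Fintype.ofFinite V
  by_contra! h
  obtain ⟨m, hm⟩ := Nat.exists_eq_add_of_le h
  obtain ⟨T, hT, hTD⟩ := exists_isTree_isContained_of_connected hk m D.toSimpleGraph
    (by rw [← hm, ← Nat.card_coe_set_eq, ← Nat.card_eq_fintype_card]; rfl)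
    D.connected_toSimpleGraph
  exact hB T hT (hTD.trans (Embedding.induce _).isContained)

theorem treeFree_of_fibers_lt [Fintype V] {k : ℕ} {B : SimpleGraph V} {α : Type*} {f : V → α}
    (hB : ∀ a b, B.Adj a b → f a = f b) (hf : ∀ v, {w | f w = f v}.ncard < k) : TreeFree k B := by
  rintro T hT ⟨φ⟩
  obtain ⟨a⟩ := hT.connected.nonempty
  have hconst : ∀ b, f (φ b) = f (φ a) := by
    intro b
    obtain ⟨p⟩ := hT.connected b a
    induction p with
    | nil => rfl
    | cons h _ ih => exact (hB _ _ (φ.toHom.map_adj h)).trans ih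
  refine (hf (φ a)).not_ge ?_
  calc k = (Set.range φ).ncard := by
        rw [← Set.image_univ, Set.ncard_image_of_injective (f := φ) _ φ.injective]; simp
    _ ≤ _ := Set.ncard_le_ncard (by rintro _ ⟨b, rfl⟩; exact hconst b) (Set.toFinite _)

/-- The coloring of `G` whose red edges are the edges in `R`. -/
noncomputable def coloringOf (G R : SimpleGraph V) : G.EdgeLabeling Color := by
  classical
  exact fun e => if e.1 ∈ R.edgeSet then Color.red else Color.blue

theorem redGraph_coloringOf_adj {G R : SimpleGraph V} {a b : V} :
    (redGraph (coloringOf G R)).Adj a b ↔ G.Adj a b ∧ R.Adj a b := by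
  simp only [redGraph, EdgeLabeling.labelGraph_adj, coloringOf, mem_edgeSet]
  by_cases h : R.Adj a b <;> simp [h]

theorem blueGraph_coloringOf_adj {G R : SimpleGraph V} {a b : V} :
    (blueGraph (coloringOf G R)).Adj a b ↔ G.Adj a b ∧ ¬ R.Adj a b := by
  simp only [blueGraph, EdgeLabeling.labelGraph_adj, coloringOf, mem_edgeSet]
  by_cases h : R.Adj a b <;> simp [h]

/-- A connected blue subgraph stays inside one class of `f`, so small classes exclude blue trees on
`k` vertices whatever the blue edges inside the classes are. -/
theorem isCriticalColoring_coloringOf [Fintype V] {t k : ℕ} {G R : SimpleGraph V} {α : Type*}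
    {f : V → α} (hR : R.CliqueFree t) (hf : ∀ v, {w | f w = f v}.ncard < k)
    (h : ∀ a b, G.Adj a b → R.Adj a b ∨ f a = f b) :
    IsCriticalColoring t k (coloringOf G R) := by
  refine ⟨hR.anti fun a b hab => (redGraph_coloringOf_adj.1 hab).2,
    treeFree_of_fibers_lt (fun a b hab => ?_) hf⟩
  rw [blueGraph_coloringOf_adj] at hab
  exact (h a b hab.1).resolve_left hab.2

/-- No edge can be added to a co-critical graph such that all edges of the new graph lie in a
`K_t`-free graph or inside a class of a partition into classes with fewer than `k` elements. -/
theorem IsCoCritical.false_of_partition [Fintype V] {t k : ℕ} {G R : SimpleGraph V}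
    (hG : IsCoCritical t k G) {α : Type*} {f : V → α} (hR : R.CliqueFree t)
    (hf : ∀ v, {w | f w = f v}.ncard < k) {u v : V} (huv : u ≠ v) (hn : ¬ G.Adj u v)
    (hnew : R.Adj u v ∨ f u = f v) (h : ∀ a b, G.Adj a b → R.Adj a b ∨ f a = f b) : False := by
  have hcrit : IsCriticalColoring t k (coloringOf (G ⊔ edge u v) R) := by
    refine isCriticalColoring_coloringOf hR hf fun a b hab => ?_
    rw [sup_adj, edge_adj] at hab
    rcases hab with hab | ⟨⟨rfl, rfl⟩ | ⟨rfl, rfl⟩, -⟩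
    · exact h a b hab
    · exact hnew
    · exact hnew.imp (fun h => h.symm) Eq.symm
  rcases hG.2.2 u v huv hn (coloringOf (G ⊔ edge u v) R) with h1 | h1
  exacts [h1 hcrit.1, h1 hcrit.2]

/-- If adding the edge `xy` to a `K_t`-free graph creates a `K_t`, then `x` and `y` have a common
`K_{t-2}`. -/
theorem exists_isNClique_subset_commonNeighbors {t : ℕ} {R : SimpleGraph V} (hR : R.CliqueFree t)
    {x y : V} (hxy : x ≠ y) {C : Finset V} (hC : (R ⊔ edge x y).IsNClique t C) :
    ∃ S : Finset V, R.IsNClique (t - 2) S ∧ (S : Set V) ⊆ R.commonNeighbors x y ∧ S ⊆ C := by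
  classical
  have hx : x ∈ C := hR.mem_of_sup_edge_isNClique hC
  have hC' : (R ⊔ edge y x).IsNClique t C := by rwa [edge_comm]
  have hy : y ∈ C := hR.mem_of_sup_edge_isNClique hC'
  have h1 := hC.erase_of_sup_edge_of_mem hx
  have h2 := hC'.erase_of_sup_edge_of_mem hy
  have hyx : y ∈ C.erase x := Finset.mem_erase.2 ⟨hxy.symm, hy⟩
  have hxy' : x ∈ C.erase y := Finset.mem_erase.2 ⟨hxy, hx⟩
  refine ⟨(C.erase x).erase y, ⟨h1.isClique.subset ?_, ?_⟩, ?_, ?_⟩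
  · exact_mod_cast Finset.erase_subset _ _
  · rw [Finset.card_erase_of_mem hyx, h1.card_eq]; omega
  · intro s hs
    simp only [Finset.coe_erase, Set.mem_sdiff, Set.mem_singleton_iff, Finset.mem_coe] at hs
    rw [mem_commonNeighbors]
    exact ⟨h2.isClique (by simp [hx, hxy]) (by simp [hs]) (Ne.symm hs.1.2),
      h1.isClique (by simp [hy, hxy.symm]) (by simp [hs]) (Ne.symm hs.2)⟩
  · exact (Finset.erase_subset _ _).trans (Finset.erase_subset _ _)

/-- Adjacent vertices of a `K_t`-free graph have no common `K_{t-2}`. -/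
theorem not_adj_of_subset_commonNeighbors {t : ℕ} (ht : 2 ≤ t) {R : SimpleGraph V}
    (hR : R.CliqueFree t) {x y : V} {S : Finset V} (hS : R.IsNClique (t - 2) S)
    (hSxy : (S : Set V) ⊆ R.commonNeighbors x y) : ¬ R.Adj x y := by
  classical
  intro h
  have h1 : R.IsNClique (t - 2 + 1) (insert y S) := hS.insert fun s hs => (hSxy hs).2
  have h2 : R.IsNClique (t - 2 + 1 + 1) (insert x (insert y S)) := by
    refine h1.insert fun s hs => ?_
    rcases Finset.mem_insert.1 hs with rfl | hs
    exacts [h, (hSxy hs).1]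
  exact hR _ (by convert h2; omega)

/-- The data extracted from a maximal critical coloring: `R` and `B` are the red and the blue
graph, `f` sends a vertex to its blue component and `H` is the graph of edges of `G` between
distinct components. -/
structure CriticalData (t k : ℕ) [Fintype V] (G R B H : SimpleGraph V) {α : Type*} (f : V → α) :
    Prop where
  three_le_t : 3 ≤ t
  three_le_k : 3 ≤ k
  coCritical : IsCoCritical t k G
  cliqueFree : R.CliqueFree t
  ncard_fiber_lt : ∀ v, {w | f w = f v}.ncard < k
  adj_iff : ∀ a b, G.Adj a b ↔ R.Adj a b ∨ B.Adj a b
  not_red_of_blue : ∀ a b, B.Adj a b → ¬ R.Adj a b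
  eq_iff_reachable : ∀ a b, f a = f b ↔ B.Reachable a b
  cross_adj_iff : ∀ a b, H.Adj a b ↔ G.Adj a b ∧ f a ≠ f b
  saturated : ∀ x y, x ≠ y → ¬ R.Adj x y →
    ∃ S : Finset V, R.IsNClique (t - 2) S ∧ (S : Set V) ⊆ R.commonNeighbors x y

theorem crossGraph_adj {G : SimpleGraph V} (τ : G.EdgeLabeling Color) {a b : V} :
    (crossGraph τ).Adj a b ↔ G.Adj a b ∧
      (blueGraph τ).connectedComponentMk a ≠ (blueGraph τ).connectedComponentMk b := by
  simp only [crossGraph, deleteEdges_adj, Set.mem_ofPred_eq, Sym2.mem_iff, forall_eq_or_imp,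
    forall_eq, ConnectedComponent.mem_supp_iff, not_exists, not_and, ne_eq]
  exact and_congr_right fun _ => ⟨fun h e => h _ e rfl, fun h D h1 h2 => h (h1.trans h2.symm)⟩

theorem adj_iff_redGraph_or_blueGraph {G : SimpleGraph V} (τ : G.EdgeLabeling Color) {a b : V} :
    G.Adj a b ↔ (redGraph τ).Adj a b ∨ (blueGraph τ).Adj a b := by
  simp only [redGraph, blueGraph, EdgeLabeling.labelGraph_adj]
  constructor
  · intro h
    cases hc : τ ⟨s(a, b), h⟩
    exacts [.inl ⟨h, hc⟩, .inr ⟨h, hc⟩]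
  · rintro (⟨h, -⟩ | ⟨h, -⟩) <;> exact h

theorem not_redGraph_adj_of_blueGraph_adj {G : SimpleGraph V} (τ : G.EdgeLabeling Color) {a b : V}
    (h : (blueGraph τ).Adj a b) : ¬ (redGraph τ).Adj a b := by
  simp only [redGraph, blueGraph, EdgeLabeling.labelGraph_adj] at h ⊢
  rintro ⟨h1, h2⟩
  obtain ⟨h3, h4⟩ := h
  rw [h2] at h4
  cases h4

/-- The point is saturation of the red graph. If `xy` could be made red without a red `K_t`, then
for `xy` in `G` the recoloring has more red edges, and for `xy` not in `G` it contradicts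
co-criticality. -/
theorem IsMaxRedCriticalColoring.criticalData [Fintype V] {t k : ℕ} (ht : 3 ≤ t) (hk : 3 ≤ k)
    {G : SimpleGraph V} (hG : IsCoCritical t k G) {τ : G.EdgeLabeling Color}
    (hτ : IsMaxRedCriticalColoring t k τ) :
    CriticalData t k G (redGraph τ) (blueGraph τ) (crossGraph τ)
      (blueGraph τ).connectedComponentMk := by
  have hfib : ∀ v, {w | (blueGraph τ).connectedComponentMk w =
      (blueGraph τ).connectedComponentMk v}.ncard < k := fun v =>
    hτ.1.2.ncard_supp_lt (by omega) ((blueGraph τ).connectedComponentMk v)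
  refine ⟨ht, hk, hG, hτ.1.1, hfib, fun a b => adj_iff_redGraph_or_blueGraph τ,
    fun a b => not_redGraph_adj_of_blueGraph_adj τ, fun a b => ConnectedComponent.eq,
    fun a b => crossGraph_adj τ, fun x y hxy hR => ?_⟩
  suffices h : ¬ (redGraph τ ⊔ edge x y).CliqueFree t by
    simp only [CliqueFree, not_forall, not_not] at h
    obtain ⟨C, hC⟩ := h
    obtain ⟨S, hS, hSxy, -⟩ := exists_isNClique_subset_commonNeighbors hτ.1.1 hxy hC
    exact ⟨S, hS, hSxy⟩
  intro hfree
  have hcov : ∀ a b, G.Adj a b → (redGraph τ ⊔ edge x y).Adj a b ∨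
      (blueGraph τ).connectedComponentMk a = (blueGraph τ).connectedComponentMk b := by
    intro a b hab
    rcases (adj_iff_redGraph_or_blueGraph τ).1 hab with h | h
    exacts [.inl (.inl h), .inr (ConnectedComponent.eq.2 h.reachable)]
  by_cases hxyG : G.Adj x y
  · refine (hτ.2 _ (isCriticalColoring_coloringOf hfree hfib hcov)).not_gt ?_
    refine Set.ncard_lt_ncard ?_ (Set.toFinite _)
    refine edgeSet_ssubset_edgeSet.2 (lt_of_le_of_ne (fun a b hab => ?_) fun h => hR ?_)
    · exact redGraph_coloringOf_adj.2 ⟨(adj_iff_redGraph_or_blueGraph τ).2 (.inl hab), .inl hab⟩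
    · rw [h]
      exact redGraph_coloringOf_adj.2 ⟨hxyG, .inr (by simp [edge_adj, hxy])⟩
  · exact hG.false_of_partition hfree hfib hxy hxyG (.inl (.inr (by simp [edge_adj, hxy]))) hcov

end
end CoCritical

namespace CoCritical

open SimpleGraph

/-! ### Hajnal's theorem on the minimum degree of saturated graphs -/

section Hajnal

open scoped Classical

variable {V : Type*}

theorem card_lt_of_isClique_of_cliqueFree {t : ℕ} {R : SimpleGraph V} (hR : R.CliqueFree t)
    {Q : Finset V} (hQ : R.IsClique Q) : Q.card < t := by
  by_contra! h
  exact hR.mono h Q ⟨hQ, rfl⟩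

variable [Fintype V]

/-- Hajnal's inequality for the intersection and the union of a family of maximum cliques. -/
theorem two_mul_le_card_inter_add_card_union {n : ℕ} {R : SimpleGraph V} {F : Finset (Finset V)}
    (hF : F.Nonempty) (hn : ∀ K ∈ F, R.IsNClique n K)
    (hmax : ∀ Q : Finset V, Q ⊆ F.biUnion id → R.IsClique Q → Q.card ≤ n) :
    2 * n ≤ ({v | ∀ K ∈ F, v ∈ K} : Finset V).card + (F.biUnion id).card := by
  induction hF using Finset.Nonempty.cons_induction with
  | singleton K =>
    have := (hn K (by simp)).card_eq
    simp [this, two_mul]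
  | cons K F hK hF ih =>
    simp only [Finset.mem_cons, forall_eq_or_imp] at hn
    rw [Finset.cons_eq_insert, Finset.biUnion_insert, id] at hmax ⊢
    have ih := ih hn.2 fun Q hQ => hmax Q (hQ.trans Finset.subset_union_right)
    set C : Finset V := {v | ∀ K ∈ F, v ∈ K} with hC
    set U := F.biUnion id with hU
    have hCU : C ⊆ U := by
      intro v hv
      obtain ⟨L, hL⟩ := hF
      simp only [hC, Finset.mem_filter, Finset.mem_univ, true_and] at hv
      exact Finset.mem_biUnion.2 ⟨L, hL, hv L hL⟩
    have hadj : ∀ a ∈ C, ∀ b ∈ U, a ≠ b → R.Adj a b := by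
      intro a ha b hb hab
      simp only [hC, Finset.mem_filter, Finset.mem_univ, true_and] at ha
      obtain ⟨L, hL, hbL⟩ := Finset.mem_biUnion.1 hb
      exact (hn.2 L hL).isClique (ha L hL) hbL hab
    -- Each vertex of `C` lies in every clique of `F`, so it is joined to all of `U`. Passing from
    -- `F` to `F ∪ {K}`, the intersection then loses no more than the union gains.
    have hQ : ((K ∩ U) ∪ C).card ≤ n := by
      refine hmax _ ((Finset.union_subset Finset.inter_subset_right hCU).trans
        Finset.subset_union_right) ?_
      intro a ha b hb hab
      simp only [Finset.coe_union, Finset.coe_inter, Set.mem_union, Set.mem_inter_iff,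
        Finset.mem_coe] at ha hb
      rcases ha with ha | ha
      · rcases hb with hb | hb
        · exact hn.1.isClique ha.1 hb.1 hab
        · exact (hadj b hb a ha.2 hab.symm).symm
      · exact hadj a ha b (hb.elim (fun h => h.2) fun h => hCU h) hab
    have hCK : ({v | ∀ L ∈ insert K F, v ∈ L} : Finset V) = K ∩ C := by
      ext v
      simp [hC]
    rw [hCK]
    have h1 := Finset.card_union_add_card_inter (K ∩ U) C
    have h2 := Finset.card_union_add_card_inter K U
    have h3 : K ∩ U ∩ C = K ∩ C := by
      rw [Finset.inter_assoc, Finset.inter_eq_right.2 hCU]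
    rw [h3] at h1
    have := hn.1.card_eq
    omega

/-- A `K_t`-saturated graph without a vertex adjacent to all others has minimum degree at least
`2 (t - 2)`. -/
theorem two_mul_le_card_neighbors_of_saturated {t : ℕ} (ht : 2 ≤ t) {R : SimpleGraph V}
    (hR : R.CliqueFree t)
    (hsat : ∀ x y, x ≠ y → ¬ R.Adj x y →
      ∃ S : Finset V, R.IsNClique (t - 2) S ∧ (S : Set V) ⊆ R.commonNeighbors x y)
    (hcon : ∀ x, ∃ y, x ≠ y ∧ ¬ R.Adj x y) (x : V) :
    2 * (t - 2) ≤ ({y | R.Adj x y} : Finset V).card := by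
  by_contra! hlt
  set N : Finset V := {y | R.Adj x y} with hN
  have memN : ∀ y, y ∈ N ↔ R.Adj x y := by simp [hN]
  set F : Finset (Finset V) := {K ∈ N.powerset | R.IsNClique (t - 2) K} with hF
  have memF : ∀ K, K ∈ F ↔ K ⊆ N ∧ R.IsNClique (t - 2) K := by simp [hF]
  have hFx : ∀ y, x ≠ y → ¬ R.Adj x y → ∃ S ∈ F, ∀ z ∈ S, R.Adj y z := by
    intro y hxy hy
    obtain ⟨S, hS, hSxy⟩ := hsat x y hxy hy
    exact ⟨S, (memF S).2 ⟨fun z hz => (memN z).2 (hSxy hz).1, hS⟩, fun z hz => (hSxy hz).2⟩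
  have hFne : F.Nonempty := by
    obtain ⟨y, hxy, hy⟩ := hcon x
    obtain ⟨S, hS, -⟩ := hFx y hxy hy
    exact ⟨S, hS⟩
  set U := F.biUnion id with hU
  have hUN : U ⊆ N := Finset.biUnion_subset.2 fun K hK => ((memF K).1 hK).1
  have hTU := two_mul_le_card_inter_add_card_union hFne (fun K hK => ((memF K).1 hK).2) (by
    intro Q hQ hQc
    have : R.IsClique (insert x Q : Finset V) := by
      rw [Finset.coe_insert]
      exact hQc.insert fun y hy _ => (memN y).1 (hUN (hQ hy))
    have h2 := card_lt_of_isClique_of_cliqueFree hR this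
    rw [Finset.card_insert_of_notMem fun hx => R.loopless.irrefl x
      ((memN x).1 (hUN (hQ hx)))] at h2
    omega)
  set T : Finset V := {v | ∀ K ∈ F, v ∈ K} with hT
  have memT : ∀ z, z ∈ T ↔ ∀ K ∈ F, z ∈ K := by simp [hT]
  have hTsU : T ⊆ U := fun z hz => by
    obtain ⟨K, hK⟩ := hFne
    exact Finset.mem_biUnion.2 ⟨K, hK, (memT z).1 hz K hK⟩
  set W := N \ U with hW
  have hWT : W.card < T.card := by
    have := Finset.card_sdiff_add_card_eq_card hUN
    rw [← hW] at this
    rw [← hU] at hTU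
    omega
  -- Non-neighbors of a vertex of `T` all lie in `W`: a vertex of `U` shares a clique of `F` with
  -- it, and a non-neighbor of `x` is joined to a whole clique of `F`, hence to `T`.
  have hoff : ∀ z ∈ T, ∀ v, v ∉ W → z ≠ v → R.Adj z v := by
    intro z hz v hv hzv
    by_cases hxv : x = v
    · subst hxv
      exact ((memN z).1 (hUN (hTsU hz))).symm
    by_cases hvN : R.Adj x v
    · have hvU : v ∈ U := by
        by_contra hvU
        exact hv (Finset.mem_sdiff.2 ⟨(memN v).2 hvN, hvU⟩)
      obtain ⟨K, hK, hvK⟩ := Finset.mem_biUnion.1 hvU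
      exact ((memF K).1 hK).2.isClique ((memT z).1 hz K hK) hvK hzv
    · obtain ⟨S, hS, hSv⟩ := hFx v hxv hvN
      exact (hSv z ((memT z).1 hz S hS)).symm
  have hTW : ∀ z ∈ T, z ∉ W := fun z hz hzW => (Finset.mem_sdiff.1 hzW).2 (hTsU hz)
  let miss : Finset V → Finset V := fun X => {z ∈ T | ∃ w ∈ X, ¬ R.Adj z w}
  have mem_miss : ∀ X z, z ∈ miss X ↔ z ∈ T ∧ ∃ w ∈ X, ¬ R.Adj z w := by simp [miss]
  -- An extremal argument in the style of Hall's theorem. Since `|W| < |T|`, some `z ∈ T` is joined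
  -- to all of `X`; saturation at `z` and a non-neighbor `w ∈ W` will produce a larger admissible
  -- set.
  obtain ⟨X, hX, hXmax⟩ := Finset.exists_max_image
    (W.powerset.filter fun X => (miss X).card ≤ X.card) Finset.card ⟨∅, by simp [miss]⟩
  simp only [Finset.mem_filter, Finset.mem_powerset] at hX hXmax
  obtain ⟨z, hzT, hzX⟩ : ∃ z ∈ T, z ∉ miss X := by
    by_contra! h
    have h1 := Finset.card_le_card h
    have h2 := Finset.card_le_card hX.1
    omega
  obtain ⟨w, hzw, hnzw⟩ := hcon z
  have hwW : w ∈ W := by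
    by_contra hwW
    exact hnzw (hoff z hzT w hwW hzw)
  have hwX : w ∉ X := fun hwX => hzX ((mem_miss X z).2 ⟨hzT, w, hwX, hnzw⟩)
  obtain ⟨S, hS, hSzw⟩ := hsat z w hzw hnzw
  have hQ := hS.insert (a := w) fun s hs => (hSzw hs).2
  set Q := insert w S with hQdef
  set A := Q ∩ W with hA
  set A' := A \ X with hA'
  set T1 : Finset V := {z ∈ T | ∀ w ∈ A ∩ X, R.Adj z w} with hT1
  have memT1 : ∀ z, z ∈ T1 ↔ z ∈ T ∧ ∀ w ∈ A ∩ X, R.Adj z w := by simp [hT1]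
  have hA'Q : A' ⊆ Q := Finset.sdiff_subset.trans Finset.inter_subset_left
  have hcross : ∀ q ∈ Q \ A', ∀ z ∈ T1, z ≠ q → R.Adj z q := by
    intro q hq z hz hzq
    rw [Finset.mem_sdiff] at hq
    by_cases hqW : q ∈ W
    · have hqA : q ∈ A := Finset.mem_inter.2 ⟨hq.1, hqW⟩
      have hqX : q ∈ X := by
        by_contra hqX
        exact hq.2 (Finset.mem_sdiff.2 ⟨hqA, hqX⟩)
      exact ((memT1 z).1 hz).2 q (Finset.mem_inter.2 ⟨hqA, hqX⟩)
    · exact hoff z ((memT1 z).1 hz).1 q hqW hzq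
  -- `Q` has `t - 1` vertices. Exchanging `A'` for `T1` keeps a clique, so at most `|A'|` vertices
  -- of `T1` are new. They include all the vertices by which `miss` grows when `A` is added to `X`.
  have hQ' : R.IsClique ((Q \ A') ∪ T1 : Finset V) := by
    intro a ha b hb hab
    rw [Finset.mem_coe, Finset.mem_union] at ha hb
    rcases ha with ha | ha
    · rcases hb with hb | hb
      · exact hQ.isClique (Finset.mem_sdiff.1 ha).1 (Finset.mem_sdiff.1 hb).1 hab
      · exact (hcross a ha b hb hab.symm).symm
    · rcases hb with hb | hb
      · exact hcross b hb a ha hab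
      · exact hoff a ((memT1 a).1 ha).1 b (hTW b ((memT1 b).1 hb).1) hab
  have hQ'card := card_lt_of_isClique_of_cliqueFree hR hQ'
  have hmiss : miss (X ∪ A) ⊆ miss X ∪ (T1 \ (Q \ A')) := by
    intro z' hz'
    rw [mem_miss] at hz'
    obtain ⟨hz'T, w', hw', hzw'⟩ := hz'
    by_cases hz'X : z' ∈ miss X
    · exact Finset.mem_union_left _ hz'X
    have hadjX : ∀ v ∈ X, R.Adj z' v := by
      intro v hv
      by_contra h
      exact hz'X ((mem_miss X z').2 ⟨hz'T, v, hv, h⟩)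
    have hw'A : w' ∈ A := (Finset.mem_union.1 hw').resolve_left fun h => hzw' (hadjX w' h)
    refine Finset.mem_union_right _ (Finset.mem_sdiff.2 ⟨(memT1 z').2
      ⟨hz'T, fun v hv => hadjX v (Finset.mem_inter.1 hv).2⟩, fun hz'Q => ?_⟩)
    refine hzw' (hQ.isClique (Finset.mem_sdiff.1 hz'Q).1 (Finset.mem_inter.1 hw'A).1 ?_)
    rintro rfl
    exact hTW _ hz'T (Finset.mem_inter.1 hw'A).2
  have hwA' : w ∈ A' := Finset.mem_sdiff.2
    ⟨Finset.mem_inter.2 ⟨Finset.mem_insert_self _ _, hwW⟩, hwX⟩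
  have hA'pos : 0 < A'.card := Finset.card_pos.2 ⟨w, hwA'⟩
  have hXA : (X ∪ A).card = X.card + A'.card := by
    rw [hA', ← Finset.card_union_of_disjoint Finset.disjoint_sdiff, Finset.union_sdiff_self_eq_union]
  have h1 := Finset.card_le_card hmiss
  have h2 := Finset.card_union_le (miss X) (T1 \ (Q \ A'))
  have h3 : ((Q \ A') ∪ T1).card = (Q \ A').card + (T1 \ (Q \ A')).card := by
    rw [← Finset.card_union_of_disjoint Finset.disjoint_sdiff, Finset.union_sdiff_self_eq_union]
  have h4 := Finset.card_sdiff_add_card_eq_card hA'Q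
  have h5 := hQ.card_eq
  have h6 := hXmax (X ∪ A) ⟨Finset.union_subset hX.1 Finset.inter_subset_right, by omega⟩
  omega

end Hajnal
end CoCritical

namespace CoCritical

open SimpleGraph

/-! ### Skew set pairs with defects -/

section SkewPairs

theorem exists_initial_subset (m : ℕ) (I : Finset ℕ) (hm : m ≤ I.card) :
    ∃ J ⊆ I, J.card = m ∧ ∀ j ∈ J, ∀ l ∈ I \ J, j < l := by
  induction m with
  | zero => exact ⟨∅, by simp⟩
  | succ m ih =>
    obtain ⟨J, hJI, hJ, hlt⟩ := ih (by omega)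
    have hne : (I \ J).Nonempty := by
      rw [← Finset.card_pos, Finset.card_sdiff_of_subset hJI]
      omega
    have hmin := Finset.min'_mem _ hne
    set x := (I \ J).min' hne
    have hx := Finset.mem_sdiff.1 hmin
    refine ⟨insert x J, Finset.insert_subset hx.1 hJI, ?_, ?_⟩
    · rw [Finset.card_insert_of_notMem hx.2, hJ]
    · intro j hj l hl
      simp only [Finset.mem_sdiff, Finset.mem_insert, not_or] at hl
      have hl' : l ∈ I \ J := Finset.mem_sdiff.2 ⟨hl.1, hl.2.2⟩
      rcases Finset.mem_insert.1 hj with rfl | hj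
      · exact lt_of_le_of_ne (Finset.min'_le _ _ hl') (Ne.symm hl.2.1)
      · exact hlt j hj l hl'

/-- An upper bound for the length of a skew system of set pairs with at most `c` defects. -/
def skewBound (b c : ℕ) : ℕ → ℕ
  | 0 => c + 1
  | a + 1 => (c + 1) + (c + 1) * b * skewBound b c a

/-- A skew version of Bollobás' set pairs theorem with defects and with a weak bound. -/
theorem card_le_skewBound {β : Type*} [DecidableEq β] (b c : ℕ) (B : ℕ → Finset β) (a : ℕ) :
    ∀ (A : ℕ → Finset β) (I : Finset ℕ), (∀ l ∈ I, (A l).card ≤ a) → (∀ l ∈ I, (B l).card ≤ b) →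
      (∀ l ∈ I, Disjoint (A l) (B l)) →
      (∀ l ∈ I, {j ∈ I | j < l ∧ Disjoint (A l) (B j)}.card ≤ c) →
      I.card ≤ skewBound b c a := by
  have key : ∀ (A : ℕ → Finset β) (I J : Finset ℕ), J ⊆ I → J.card = c + 1 →
      (∀ j ∈ J, ∀ l ∈ I \ J, j < l) →
      (∀ l ∈ I, {j ∈ I | j < l ∧ Disjoint (A l) (B j)}.card ≤ c) →
      ∀ l ∈ I \ J, ∃ z ∈ A l, z ∈ J.biUnion B := by
    intro A I J hJI hJ hlt hc l hl
    by_contra! h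
    have hsub : J ⊆ {j ∈ I | j < l ∧ Disjoint (A l) (B j)} := by
      intro j hj
      refine Finset.mem_filter.2 ⟨hJI hj, hlt j hj l hl, ?_⟩
      rw [Finset.disjoint_left]
      exact fun z hz hzB => h z hz (Finset.mem_biUnion.2 ⟨j, hj, hzB⟩)
    have := (Finset.card_le_card hsub).trans (hc l (Finset.mem_sdiff.1 hl).1)
    omega
  induction a with
  | zero =>
    intro A I hA hB hAB hc
    by_contra! hlt
    rw [skewBound] at hlt
    obtain ⟨J, hJI, hJ, hJlt⟩ := exists_initial_subset (c + 1) I hlt.le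
    obtain ⟨l, hl⟩ : (I \ J).Nonempty := by
      rw [← Finset.card_pos, Finset.card_sdiff_of_subset hJI]
      omega
    obtain ⟨z, hz, -⟩ := key A I J hJI hJ hJlt hc l hl
    have := hA l (Finset.mem_sdiff.1 hl).1
    rw [Nat.le_zero, Finset.card_eq_zero] at this
    simp [this] at hz
  | succ a ih =>
    intro A I hA hB hAB hc
    rw [skewBound]
    -- The first `c + 1` indices form `J`. Any later `A l` meets some `B j` with `j ∈ J`, since
    -- otherwise `l` would have `c + 1` defects. So it contains one of at most `(c + 1) * b` points,
    -- and the indices are classified by such a point.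
    by_cases hI : I.card < c + 1
    · omega
    obtain ⟨J, hJI, hJ, hJlt⟩ := exists_initial_subset (c + 1) I (not_lt.1 hI)
    have hkey := key A I J hJI hJ hJlt hc
    have hcover : I \ J ⊆ (J.biUnion B).biUnion fun z => {l ∈ I | z ∈ A l} := by
      intro l hl
      obtain ⟨z, hz, hzP⟩ := hkey l hl
      exact Finset.mem_biUnion.2 ⟨z, hzP, Finset.mem_filter.2 ⟨(Finset.mem_sdiff.1 hl).1, hz⟩⟩
    have hP : (J.biUnion B).card ≤ (c + 1) * b := by
      rw [← hJ]
      exact Finset.card_biUnion_le_card_mul _ _ _ fun j hj => hB j (hJI hj)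
    have hclass : ∀ z ∈ J.biUnion B, {l ∈ I | z ∈ A l}.card ≤ skewBound b c a := by
      intro z _
      -- Deleting `z` creates no defects within its class: there `z ∈ A j`, hence `z ∉ B j`.
      refine ih (fun l => (A l).erase z) _ (fun l hl => ?_) (fun l hl => ?_) (fun l hl => ?_)
        fun l hl => ?_
      · rw [Finset.mem_filter] at hl
        rw [Finset.card_erase_of_mem hl.2]
        have := hA l hl.1
        omega
      · exact hB l (Finset.mem_filter.1 hl).1
      · exact (hAB l (Finset.mem_filter.1 hl).1).mono_left (Finset.erase_subset _ _)
      · refine (Finset.card_le_card fun j hj => ?_).trans (hc l (Finset.mem_filter.1 hl).1)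
        simp only [Finset.mem_filter] at hj ⊢
        refine ⟨hj.1.1, hj.2.1, ?_⟩
        rw [Finset.disjoint_left]
        intro w hw hwB
        by_cases hwz : w = z
        · subst hwz
          exact Finset.disjoint_left.1 (hAB j hj.1.1) hj.1.2 hwB
        · exact Finset.disjoint_left.1 hj.2.2 (Finset.mem_erase.2 ⟨hwz, hw⟩) hwB
    have h1 := (Finset.card_le_card hcover).trans (Finset.card_biUnion_le_card_mul _ _ _ hclass)
    have h2 := Nat.mul_le_mul_right (skewBound b c a) hP
    rw [Finset.card_sdiff_of_subset hJI] at h1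
    omega

end SkewPairs

/-! ### Day's theorem by a closure process -/

section MinimumDegree

open scoped Classical

variable {V : Type*} [Fintype V]

/-- Twice the number of edges of `H` inside `C`. -/
noncomputable def innerDegreeSum (H : SimpleGraph V) (C : Finset V) : ℕ :=
  ∑ v ∈ C, (H.neighborFinset v ∩ C).card

theorem innerDegreeSum_insert (H : SimpleGraph V) {C : Finset V} {y : V} (hy : y ∉ C) :
    innerDegreeSum H (insert y C) = innerDegreeSum H C + 2 * (H.neighborFinset y ∩ C).card := by
  rw [innerDegreeSum, Finset.sum_insert hy, innerDegreeSum]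
  have h1 : H.neighborFinset y ∩ insert y C = H.neighborFinset y ∩ C :=
    Finset.inter_insert_of_notMem (by simp)
  have h2 : ∀ v ∈ C, (H.neighborFinset v ∩ insert y C).card =
      (H.neighborFinset v ∩ C).card + if H.Adj y v then 1 else 0 := by
    intro v _
    split_ifs with h
    · rw [Finset.inter_insert_of_mem (by simpa using h.symm),
        Finset.card_insert_of_notMem (by simp [hy])]
    · rw [Finset.inter_insert_of_notMem (by simpa [H.adj_comm] using h), add_zero]
  rw [h1, Finset.sum_congr rfl h2, Finset.sum_add_distrib, ← Finset.card_filter]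
  have h3 : {v ∈ C | H.Adj y v} = H.neighborFinset y ∩ C := by
    ext v
    simp [and_comm]
  rw [h3]
  ring

theorem innerDegreeSum_mono (H : SimpleGraph V) {C C' : Finset V} (h : C ⊆ C') :
    innerDegreeSum H C ≤ innerDegreeSum H C' :=
  (Finset.sum_le_sum fun _ _ => Finset.card_le_card (Finset.inter_subset_inter_left h)).trans
    (Finset.sum_le_sum_of_subset h)

/-- `C` spans at least `q |C| - r / 2` edges, and no vertex outside `C` has `q` neighbors
in `C`. -/
structure IsClosedDense (H : SimpleGraph V) (q r : ℕ) (C : Finset V) : Prop where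
  dense : 2 * q * C.card ≤ innerDegreeSum H C + r
  card_lt : ∀ y ∉ C, (H.neighborFinset y ∩ C).card < q

theorem IsClosedDense.mono {H : SimpleGraph V} {q r r' : ℕ} {C : Finset V}
    (h : IsClosedDense H q r C) (hr : r ≤ r') : IsClosedDense H q r' C :=
  ⟨h.dense.trans (by omega), h.card_lt⟩

/-- Adding `S` costs at most `2 * q * m`. Adding a vertex with at least `q` neighbors in the set
costs nothing further, so a largest dense set containing `C ∪ S` is closed. -/
theorem exists_isClosedDense {H : SimpleGraph V} {q r m : ℕ} {C S : Finset V}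
    (hC : 2 * q * C.card ≤ innerDegreeSum H C + r) (hS : S.card ≤ m) :
    ∃ C', C ⊆ C' ∧ S ⊆ C' ∧ IsClosedDense H q (r + 2 * q * m) C' := by
  have h0 : 2 * q * (C ∪ S).card ≤ innerDegreeSum H (C ∪ S) + (r + 2 * q * m) := by
    calc 2 * q * (C ∪ S).card ≤ 2 * q * (C.card + m) :=
          Nat.mul_le_mul_left _ ((Finset.card_union_le _ _).trans (by omega))
      _ = 2 * q * C.card + 2 * q * m := by ring
      _ ≤ _ := by
        have := innerDegreeSum_mono H (Finset.subset_union_left (s₁ := C) (s₂ := S))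
        omega
  obtain ⟨C', hC', hmax⟩ := Finset.exists_max_image (Finset.univ.filter fun C' : Finset V =>
    C ∪ S ⊆ C' ∧ 2 * q * C'.card ≤ innerDegreeSum H C' + (r + 2 * q * m)) Finset.card
    ⟨C ∪ S, by simpa using h0⟩
  simp only [Finset.mem_filter, Finset.mem_univ, true_and] at hC' hmax
  refine ⟨C', Finset.subset_union_left.trans hC'.1, Finset.subset_union_right.trans hC'.1,
    hC'.2, fun y hy => ?_⟩
  by_contra! hq
  have := hmax (insert y C') ⟨hC'.1.trans (Finset.subset_insert _ _), by
    rw [Finset.card_insert_of_notMem hy, innerDegreeSum_insert H hy, mul_add]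
    have := hC'.2
    omega⟩
  rw [Finset.card_insert_of_notMem hy] at this
  omega

/-- A vertex outside `C` of small weight, where edges to `C` count fully and all others half. -/
def IsLight (H : SimpleGraph V) (q : ℕ) (C : Finset V) (y : V) : Prop :=
  y ∉ C ∧ 2 * (H.neighborFinset y ∩ C).card + (H.neighborFinset y \ C).card < 2 * q

theorem card_inter_add_card_sdiff_neighborFinset (H : SimpleGraph V) (C : Finset V) (y : V) :
    (H.neighborFinset y ∩ C).card + (H.neighborFinset y \ C).card = (H.neighborFinset y).card :=
  Finset.card_inter_add_card_sdiff _ _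

/-- Enlarging the set only moves edges from weight one to weight two. -/
theorem IsLight.anti {H : SimpleGraph V} {q : ℕ} {C C' : Finset V} {y : V} (h : C ⊆ C')
    (hy : IsLight H q C' y) : IsLight H q C y := by
  refine ⟨fun hyC => hy.1 (h hyC), ?_⟩
  have h1 := card_inter_add_card_sdiff_neighborFinset H C y
  have h2 := card_inter_add_card_sdiff_neighborFinset H C' y
  have h3 : (H.neighborFinset y ∩ C).card ≤ (H.neighborFinset y ∩ C').card :=
    Finset.card_le_card (Finset.inter_subset_inter_left h)
  have := hy.2
  omega

/-- Counting the edges between `C` and its complement from the outside, the degree sum is the inner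
degree sum of `C` plus the weights of the outer vertices, each of which is at least `2 * q`. -/
theorem two_mul_card_le_of_forall_not_isLight {H : SimpleGraph V} {q r : ℕ} {C : Finset V}
    (hC : IsClosedDense H q r C) (hlight : ∀ y, ¬ IsLight H q C y) :
    2 * q * Fintype.card V ≤ ∑ v, H.degree v + r := by
  have hdeg : ∀ v, H.degree v =
      (H.neighborFinset v ∩ C).card + (H.neighborFinset v \ C).card := fun v =>
    (card_inter_add_card_sdiff_neighborFinset H C v).symm
  have hswap : ∑ v ∈ C, (H.neighborFinset v \ C).card =
      ∑ y ∈ Cᶜ, (H.neighborFinset y ∩ C).card := by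
    have e1 : ∀ v, H.neighborFinset v \ C = {y ∈ Cᶜ | H.Adj v y} := fun v => by
      ext y; simp [and_comm]
    have e2 : ∀ y, H.neighborFinset y ∩ C = {v ∈ C | H.Adj v y} := fun y => by
      ext v; simp [and_comm, H.adj_comm]
    simp only [e1, e2]
    exact Finset.sum_card_bipartiteAbove_eq_sum_card_bipartiteBelow H.Adj
  have hout : 2 * q * Cᶜ.card ≤
      ∑ y ∈ Cᶜ, (2 * (H.neighborFinset y ∩ C).card + (H.neighborFinset y \ C).card) := by
    rw [mul_comm, ← smul_eq_mul]
    refine Finset.card_nsmul_le_sum _ _ _ fun y hy => ?_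
    by_contra! h
    exact hlight y ⟨Finset.mem_compl.1 hy, h⟩
  have hin := hC.dense
  rw [innerDegreeSum] at hin
  rw [← Finset.sum_add_sum_compl C, Finset.sum_congr rfl fun v _ => hdeg v,
    Finset.sum_congr (s₁ := Cᶜ) rfl fun v _ => hdeg v, Finset.sum_add_distrib,
    Finset.sum_add_distrib, hswap, ← Finset.card_add_card_compl C, mul_add]
  rw [Finset.sum_add_distrib, ← Finset.mul_sum] at hout
  omega

/-- The deficit after the `i`-th round of the closure process. -/
def deficitBound (q k : ℕ) : ℕ → ℕ
  | 0 => 0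
  | i + 1 => deficitBound q k i +
      (skewBound q (2 * q * q) i + 2) * (2 * q * (2 * q + 1 + k))

/-- One round of the closure process: the number of neighbors in the closed set of the light
vertices can be increased at the cost of a bounded deficit. -/
theorem exists_isClosedDense_succ {t k q i r : ℕ} (ht : 2 ≤ t) {H : SimpleGraph V} {α : Type*}
    {f : V → α} (hH : H.CliqueFree t) (hf : ∀ v, {w | f w = f v}.ncard < k)
    (hsat : ∀ u v, f u ≠ f v → ¬ H.Adj u v →
      ∃ S : Finset V, H.IsNClique (t - 2) S ∧ (S : Set V) ⊆ H.commonNeighbors u v)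
    (hdeg : ∀ v, q ≤ H.degree v) {C₀ : Finset V} (hC₀ : IsClosedDense H q r C₀)
    (hlight : ∀ y, IsLight H q C₀ y → i ≤ (H.neighborFinset y ∩ C₀).card) :
    ∃ C, IsClosedDense H q
        (r + (skewBound q (2 * q * q) i + 2) * (2 * q * (2 * q + 1 + k))) C ∧
      ∀ y, IsLight H q C y → i + 1 ≤ (H.neighborFinset y ∩ C).card := by
  set M := skewBound q (2 * q * q) i
  set s := 2 * q * (2 * q + 1 + k)
  by_contra! hcon
  -- If the round fails, each intermediate set `C` has a light `y` with at most `i` neighbors in it.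
  -- By `hlight` these are exactly its neighbors in `C₀`. Lightness and degree at least `q` give a
  -- neighbor `x` of `y` outside `C`; the next set absorbs the neighborhood of `y` and the class of
  -- `x`, at most `2 * q + 1 + k` vertices.
  have key : ∀ (l : ℕ) (C : Finset V), l ≤ M + 1 → C₀ ⊆ C ∧ IsClosedDense H q (r + l * s) C →
      ∃ (y x : V) (C' : Finset V), y ∉ C ∧ (H.neighborFinset y).card ≤ 2 * q ∧
        (H.neighborFinset y ∩ C₀).card ≤ i ∧ H.neighborFinset y ∩ C ⊆ C₀ ∧ H.Adj y x ∧ x ∉ C ∧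
        C ⊆ C' ∧ x ∈ C' ∧ (∀ z, f z = f x → z ∈ C') ∧
        C₀ ⊆ C' ∧ IsClosedDense H q (r + (l + 1) * s) C' := by
    rintro l C hl ⟨hC₀C, hC⟩
    obtain ⟨y, hy, hyi⟩ := hcon C (hC.mono (by
      have := Nat.mul_le_mul_right s (show l ≤ M + 2 by omega)
      omega))
    have hi' := hlight y (hy.anti hC₀C)
    have hsub : H.neighborFinset y ∩ C₀ ⊆ H.neighborFinset y ∩ C :=
      Finset.inter_subset_inter_left hC₀C
    have heq := Finset.eq_of_subset_of_card_le hsub (by omega)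
    have hsum := card_inter_add_card_sdiff_neighborFinset H C y
    have hd : q ≤ (H.neighborFinset y).card := hdeg y
    have hle := hy.2
    obtain ⟨x, hx⟩ : (H.neighborFinset y \ C).Nonempty := Finset.card_pos.1 (by omega)
    rw [Finset.mem_sdiff, mem_neighborFinset] at hx
    have hSle : (H.neighborFinset y ∪ ({z | f z = f x} : Finset V)).card ≤ 2 * q + 1 + k := by
      refine (Finset.card_union_le _ _).trans ?_
      have := hf x
      rw [Set.ncard_eq_toFinset_card', Set.toFinset_ofPred] at this
      omega
    obtain ⟨C', hCC', hSC', hC'⟩ := exists_isClosedDense hC.dense hSle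
    refine ⟨y, x, C', hy.1, by omega, by rw [heq]; omega, ?_, hx.1, hx.2, hCC', ?_, ?_,
      hC₀C.trans hCC', ?_⟩
    · rw [← heq]
      exact Finset.inter_subset_right
    · exact hSC' (Finset.mem_union_left _ ((mem_neighborFinset _ _ _).2 hx.1))
    · exact fun z hz => hSC' (Finset.mem_union_right _ (by simpa using hz))
    · rwa [add_mul, one_mul, ← add_assoc]
  have hne : Nonempty V := by
    obtain ⟨y, -⟩ := key 0 C₀ (by omega) ⟨subset_rfl, by simpa using hC₀⟩
    exact ⟨y⟩
  choose! y x next hyC hycard hyi hyC₀ hyx hxC hsub hxnext hfnext hC₀next hnext using key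
  let Cs : ℕ → Finset V := fun l => Nat.rec C₀ (fun l C => next l C) l
  have hinv : ∀ l, l ≤ M + 1 → C₀ ⊆ Cs l ∧ IsClosedDense H q (r + l * s) (Cs l) := by
    intro l
    induction l with
    | zero => exact fun _ => ⟨subset_rfl, hC₀.mono (Nat.le_add_right _ _)⟩
    | succ l ih =>
      intro hl
      have := ih (by omega)
      exact ⟨hC₀next l _ (by omega) this, hnext l _ (by omega) this⟩
  have hmono : ∀ j l, j ≤ l → l ≤ M + 1 → Cs j ⊆ Cs l := by
    intro j l hjl
    induction l, hjl using Nat.le_induction with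
    | base => exact fun _ => subset_rfl
    | succ l _ ih =>
      intro hl
      exact (ih (by omega)).trans (hsub l _ (by omega) (hinv l (by omega)))
  let Y : ℕ → V := fun l => y l (Cs l)
  let X : ℕ → V := fun l => x l (Cs l)
  have hXmem : ∀ j l, j < l → l ≤ M + 1 → X j ∈ Cs l := fun j l hjl hl =>
    hmono (j + 1) l hjl hl (hxnext j _ (by omega) (hinv j (by omega)))
  have hXnot : ∀ j, j ≤ M + 1 → X j ∉ Cs j := fun j hj => hxC j _ hj (hinv j hj)
  -- The `A`-sets are the neighborhoods of `Y l` in `C₀`; the `B`-sets are the neighbors of `X l` in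
  -- `C₀` that `Y l` misses. Then `M + 1` steps exceed the skew bound once the defects are limited.
  have hbound := card_le_skewBound q (2 * q * q) (fun l => (H.neighborFinset (X l) ∩ C₀) \
    H.neighborFinset (Y l)) i (fun l => H.neighborFinset (Y l) ∩ C₀) (Finset.range (M + 1)) ?_ ?_ ?_
    fun l hl => ?_
  · rw [Finset.card_range] at hbound
    omega
  · intro l hl
    rw [Finset.mem_range] at hl
    exact hyi l _ (by omega) (hinv l (by omega))
  · intro l hl
    rw [Finset.mem_range] at hl
    refine (Finset.card_le_card Finset.sdiff_subset).trans (hC₀.card_lt _ fun h => ?_).le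
    exact hXnot l (by omega) ((hinv l (by omega)).1 h)
  · intro l _
    exact Finset.disjoint_sdiff.mono_left Finset.inter_subset_left
  rw [Finset.mem_range] at hl
  have hl' := hinv l (by omega)
  -- For a defect `j < l`, `X j` and `Y l` are non-adjacent in distinct classes, so they have a
  -- common `K_{t-2}`. Inside `Cs l` it would lie in `C₀` and, by disjointness, be joined to `Y j`,
  -- giving a `K_t` with the edge between `X j` and `Y j`. So `X j` is adjacent to a neighbor of `Y
  -- l` outside `Cs l`; closedness leaves at most `2 * q * q` such vertices.
  have hcard : ((H.neighborFinset (Y l) \ Cs l).biUnion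
      fun z => H.neighborFinset z ∩ Cs l).card ≤ 2 * q * q := by
    refine (Finset.card_biUnion_le_card_mul _ _ q fun z hz => ?_).trans (Nat.mul_le_mul_right q ?_)
    · exact (hl'.2.card_lt z (Finset.mem_sdiff.1 hz).2).le
    · exact (Finset.card_le_card Finset.sdiff_subset).trans (hycard l _ (by omega) hl')
  refine le_trans ?_ hcard
  refine Finset.card_le_card_of_injOn X ?_ ?_
  · intro j hj
    simp only [Finset.coe_filter, Finset.mem_range, Set.mem_ofPred_eq] at hj
    obtain ⟨hjM, hjl, hdisj⟩ := hj
    have hXl := hXmem j l hjl (by omega)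
    have hj' := hinv j (by omega)
    have hYl : Y l ∉ Cs l := hyC l _ (by omega) hl'
    have hfne : f (X j) ≠ f (Y l) := fun h => hYl (hmono (j + 1) l hjl (by omega)
      (hfnext j _ (by omega) hj' _ h.symm))
    have hnadj : ¬ H.Adj (X j) (Y l) := fun h => hXnot j (by omega)
      (hj'.1 (hyC₀ l _ (by omega) hl' (Finset.mem_inter.2
        ⟨(mem_neighborFinset _ _ _).2 h.symm, hXl⟩)))
    obtain ⟨S, hS, hSc⟩ := hsat _ _ hfne hnadj
    obtain ⟨z, hz, hzC⟩ : ∃ z ∈ S, z ∉ Cs l := by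
      by_contra! hSin
      refine not_adj_of_subset_commonNeighbors ht hH hS (fun z hz => ?_)
        (hyx j _ (by omega) hj').symm
      have hz' := hSc hz
      rw [mem_commonNeighbors] at hz' ⊢
      have hzC₀ : z ∈ C₀ := hyC₀ l _ (by omega) hl' (Finset.mem_inter.2
        ⟨(mem_neighborFinset _ _ _).2 hz'.2, hSin z hz⟩)
      refine ⟨hz'.1, ?_⟩
      by_contra hzY
      exact Finset.disjoint_left.1 hdisj
        (Finset.mem_inter.2 ⟨(mem_neighborFinset _ _ _).2 hz'.2, hzC₀⟩)
        (Finset.mem_sdiff.2 ⟨Finset.mem_inter.2 ⟨(mem_neighborFinset _ _ _).2 hz'.1, hzC₀⟩,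
          fun h => hzY ((mem_neighborFinset _ _ _).1 h)⟩)
    have hz' := hSc hz
    rw [mem_commonNeighbors] at hz'
    exact Finset.mem_coe.2 (Finset.mem_biUnion.2 ⟨z, Finset.mem_sdiff.2
      ⟨(mem_neighborFinset _ _ _).2 hz'.2, hzC⟩, Finset.mem_inter.2
      ⟨(mem_neighborFinset _ _ _).2 hz'.1.symm, hXl⟩⟩)
  · intro j hj j' hj' hXX
    simp only [Finset.coe_filter, Finset.mem_range, Set.mem_ofPred_eq] at hj hj'
    rcases lt_trichotomy j j' with h | h | h
    · exact absurd (hXX ▸ hXmem j j' h (by omega)) (hXnot j' (by omega))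
    · exact h
    · exact absurd (hXX ▸ hXmem j' j h (by omega)) (hXnot j (by omega))

/-- Day's theorem on saturated graphs of given minimum degree, for graphs whose vertices outside
of a common class of a partition into small classes are saturated. -/
theorem two_mul_card_le_sum_degree_add {t k q : ℕ} (ht : 2 ≤ t) {H : SimpleGraph V} {α : Type*}
    {f : V → α} (hH : H.CliqueFree t) (hf : ∀ v, {w | f w = f v}.ncard < k)
    (hsat : ∀ u v, f u ≠ f v → ¬ H.Adj u v →
      ∃ S : Finset V, H.IsNClique (t - 2) S ∧ (S : Set V) ⊆ H.commonNeighbors u v)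
    (hdeg : ∀ v, q ≤ H.degree v) :
    2 * q * Fintype.card V ≤ ∑ v, H.degree v + deficitBound q k q := by
  have hround : ∀ i ≤ q, ∃ C, IsClosedDense H q (deficitBound q k i) C ∧
      ∀ y, IsLight H q C y → i ≤ (H.neighborFinset y ∩ C).card := by
    intro i
    induction i with
    | zero =>
      intro _
      obtain ⟨C, -, -, hC⟩ := exists_isClosedDense (H := H) (q := q) (r := 0) (m := 0) (C := ∅)
        (S := ∅) (by simp) (by simp)
      exact ⟨C, by simpa [deficitBound] using hC, by simp⟩
    | succ i ih =>
      intro hi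
      obtain ⟨C, hC, hlight⟩ := ih (by omega)
      exact exists_isClosedDense_succ ht hH hf hsat hdeg hC hlight
  obtain ⟨C, hC, hlight⟩ := hround q le_rfl
  -- After `q` rounds a light vertex would have `q` neighbors in the closed set, so none is left.
  refine two_mul_card_le_of_forall_not_isLight hC fun y hy => ?_
  exact (hlight y hy).not_gt (hC.card_lt y hy.1)

end MinimumDegree
end CoCritical

namespace CoCritical

open SimpleGraph

/-! ### Structure of the cross graph by recoloring -/

section Structure

open scoped Classical

variable {V : Type*} [Fintype V] {t k : ℕ} {G R B H : SimpleGraph V} {α : Type*} {f : V → α}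

/-- The labelling obtained from `f` by merging the classes of `p` and `q`. -/
noncomputable def mergeClasses (f : V → α) (p q : V) (z : V) : α :=
  if f z = f p then f q else f z

omit [Fintype V] in
theorem mergeClasses_eq_of_eq {p q x y : V} (h : f x = f y) :
    mergeClasses f p q x = mergeClasses f p q y := by
  rw [mergeClasses, mergeClasses, h]

omit [Fintype V] in
theorem mergeClasses_left_eq_right (f : V → α) (p q : V) :
    mergeClasses f p q p = mergeClasses f p q q := by
  rw [mergeClasses, mergeClasses, if_pos rfl]
  split_ifs <;> rfl

theorem ncard_mergeClasses_fiber_lt (hf : ∀ v, {w | f w = f v}.ncard < k) {p q : V}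
    (hpq : {w | f w = f p}.ncard + {w | f w = f q}.ncard < k) (v : V) :
    {w | mergeClasses f p q w = mergeClasses f p q v}.ncard < k := by
  by_cases hv : f v = f p ∨ f v = f q
  · refine lt_of_le_of_lt ((Set.ncard_le_ncard ?_ (Set.toFinite _)).trans
      (Set.ncard_union_le {w | f w = f p} {w | f w = f q})) hpq
    intro w hw
    have hvq : mergeClasses f p q v = f q := by
      rw [mergeClasses]
      split_ifs with h
      exacts [rfl, hv.resolve_left h]
    rw [Set.mem_ofPred_eq, hvq, mergeClasses] at hw
    split_ifs at hw with h
    exacts [.inl h, .inr hw]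
  · rw [not_or] at hv
    refine lt_of_le_of_lt (Set.ncard_le_ncard ?_ (Set.toFinite _)) (hf v)
    intro w hw
    rw [Set.mem_ofPred_eq, mergeClasses, mergeClasses, if_neg hv.1] at hw
    split_ifs at hw with h
    exacts [absurd hw.symm hv.2, hw]

namespace CriticalData

variable (D : CriticalData t k G R B H f)
include D

theorem red_of_cross {a b : V} (h : H.Adj a b) : R.Adj a b := by
  rw [D.cross_adj_iff] at h
  refine ((D.adj_iff a b).1 h.1).resolve_right fun hB => h.2 ?_
  exact (D.eq_iff_reachable a b).2 hB.reachable

theorem ne_of_cross {a b : V} (h : H.Adj a b) : f a ≠ f b := ((D.cross_adj_iff a b).1 h).2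

theorem cross_cliqueFree : H.CliqueFree t := D.cliqueFree.anti fun _ _ h => D.red_of_cross h

theorem cross_or_eq {a b : V} (h : G.Adj a b) : H.Adj a b ∨ f a = f b := by
  by_cases hf : f a = f b
  exacts [.inr hf, .inl ((D.cross_adj_iff a b).2 ⟨h, hf⟩)]

theorem not_adj_of_not_cross {a b : V} (hf : f a ≠ f b) (h : ¬ H.Adj a b) : ¬ G.Adj a b :=
  fun hG => h ((D.cross_adj_iff a b).2 ⟨hG, hf⟩)

theorem adj_of_eq {u v : V} (h : f u = f v) (huv : u ≠ v) : G.Adj u v := by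
  by_contra hn
  exact D.coCritical.false_of_partition D.cross_cliqueFree D.ncard_fiber_lt huv hn (.inr h)
    fun a b hab => D.cross_or_eq hab

theorem exists_isNClique_sup_edge {u v : V} (hf : f u ≠ f v) (h : ¬ H.Adj u v) :
    ∃ C : Finset V, (H ⊔ edge u v).IsNClique t C := by
  by_contra hfree
  have huv : u ≠ v := fun h => hf (h ▸ rfl)
  refine D.coCritical.false_of_partition (R := H ⊔ edge u v) (fun C hC => hfree ⟨C, hC⟩)
    D.ncard_fiber_lt huv (D.not_adj_of_not_cross hf h) (.inl (.inr (by simp [edge_adj, huv])))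
    fun a b hab => (D.cross_or_eq hab).imp_left .inl

theorem exists_common_clique {u v : V} (hf : f u ≠ f v) (h : ¬ H.Adj u v) :
    ∃ S : Finset V, H.IsNClique (t - 2) S ∧ (S : Set V) ⊆ H.commonNeighbors u v := by
  obtain ⟨C, hC⟩ := D.exists_isNClique_sup_edge hf h
  obtain ⟨S, hS, hSc, -⟩ := exists_isNClique_subset_commonNeighbors D.cross_cliqueFree
    (ne_of_apply_ne f hf) hC
  exact ⟨S, hS, hSc⟩

/-- Vertices in different small components are adjacent. -/
theorem cross_adj_of_add_lt {u v : V} (hf : f u ≠ f v)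
    (hlt : {w | f w = f u}.ncard + {w | f w = f v}.ncard < k) : H.Adj u v := by
  by_contra h
  refine D.coCritical.false_of_partition (f := mergeClasses f u v) D.cross_cliqueFree
    (ncard_mergeClasses_fiber_lt D.ncard_fiber_lt hlt) (ne_of_apply_ne f hf)
    (D.not_adj_of_not_cross hf h) (.inr (mergeClasses_left_eq_right f u v))
    fun a b hab => (D.cross_or_eq hab).imp_right mergeClasses_eq_of_eq

/-- If every `K_t` created by a new edge `ab` contains the edge `pq`, then the components of `p`
and `q` cannot be merged. -/
theorem le_add_of_forall_mem {a b p q : V} (hf : f a ≠ f b) (hab : ¬ H.Adj a b) (hpq : p ≠ q)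
    (hH : H.Adj p q) (h : ∀ C : Finset V, (H ⊔ edge a b).IsNClique t C → p ∈ C ∧ q ∈ C) :
    k ≤ {w | f w = f p}.ncard + {w | f w = f q}.ncard := by
  by_contra! hlt
  have habne : a ≠ b := fun h => hf (h ▸ rfl)
  have hle : (H ⊔ edge a b) \ edge p q ≤ H ⊔ edge a b := sdiff_le
  have hcover : ∀ x y, (H ⊔ edge a b).Adj x y → ((H ⊔ edge a b) \ edge p q).Adj x y ∨
      mergeClasses f p q x = mergeClasses f p q y := by
    intro x y hxy
    by_cases hpqxy : (edge p q).Adj x y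
    · rw [edge_adj] at hpqxy
      rcases hpqxy.1 with ⟨rfl, rfl⟩ | ⟨rfl, rfl⟩
      exacts [.inr (mergeClasses_left_eq_right f _ _),
        .inr (mergeClasses_left_eq_right f _ _).symm]
    · exact .inl ⟨hxy, hpqxy⟩
  refine D.coCritical.false_of_partition (f := mergeClasses f p q)
    (R := (H ⊔ edge a b) \ edge p q) (fun C hC => ?_)
    (ncard_mergeClasses_fiber_lt D.ncard_fiber_lt hlt) habne (D.not_adj_of_not_cross hf hab)
    (hcover a b (.inr (by simp [edge_adj, habne]))) fun x y hxy => ?_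
  · have hpqC := h C (hC.mono hle)
    exact (hC.isClique hpqC.1 hpqC.2 hpq).2 (by simp [edge_adj, hpq])
  · rcases D.cross_or_eq hxy with h1 | h1
    exacts [hcover x y (.inl h1), .inr (mergeClasses_eq_of_eq h1)]

theorem nonempty : Nonempty V := by
  by_contra h
  rw [not_nonempty_iff] at h
  exact D.coCritical.1 (Subsingleton.elim _ _)

theorem exists_not_adj : ∃ u v, u ≠ v ∧ ¬ G.Adj u v := by
  by_contra! h
  refine D.coCritical.1 (top_unique fun u v huv => h u v huv)

/-- No vertex is joined to all other vertices by red edges. -/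
theorem exists_not_red (x : V) : ∃ y, x ≠ y ∧ ¬ R.Adj x y := by
  by_contra! hx
  obtain ⟨u, v, huv, hn⟩ := D.exists_not_adj
  have hRG : ∀ a b, R.Adj a b → G.Adj a b := fun a b h => (D.adj_iff a b).2 (.inl h)
  have hxu : x ≠ u := by
    rintro rfl
    exact hn (hRG _ _ (hx v huv))
  have hxv : x ≠ v := by
    rintro rfl
    exact hn (hRG _ _ (hx u huv.symm)).symm
  have hk := D.three_le_k
  -- A red-universal `x` hands its role to `u`: all edges at `u` become red except `xu`, which
  -- becomes an isolated blue edge. A red clique through `u` avoids `x`, so replacing `u` by `x`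
  -- gives an old red clique. Now `uv` can be added in red.
  set R' : SimpleGraph V :=
    SimpleGraph.fromRel fun a b => (R.Adj a b ∧ a ≠ u ∧ b ≠ u) ∨ (a = u ∧ b ≠ x) with hR'
  have hadj : ∀ a b, R'.Adj a b ↔ a ≠ b ∧ (((R.Adj a b ∧ a ≠ u ∧ b ≠ u) ∨ (a = u ∧ b ≠ x)) ∨
      ((R.Adj b a ∧ b ≠ u ∧ a ≠ u) ∨ (b = u ∧ a ≠ x))) := fun a b =>
    SimpleGraph.fromRel_adj _ a b
  have hoff : ∀ a b, a ≠ u → b ≠ u → R'.Adj a b → R.Adj a b := by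
    intro a b ha hb h
    rw [hadj] at h
    rcases h.2 with (h | h) | (h | h)
    exacts [h.1, absurd h.1 ha, h.1.symm, absurd h.1 hb]
  let f' : V → Option α := fun z => if z = u ∨ z = x then none else some (f z)
  refine D.coCritical.false_of_partition (R := R') (f := f') (t := t) (k := k) ?_ ?_ huv hn
    (.inl ((hadj u v).2 ⟨huv, .inl (.inr ⟨rfl, hxv.symm⟩)⟩)) ?_
  · intro C hC
    by_cases hu : u ∈ C
    · have hxC : x ∉ C := by
        intro hxC
        have := hC.isClique hxC hu hxu
        rw [hadj] at this
        rcases this.2 with (h | h) | (h | h)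
        exacts [h.2.2 rfl, hxu h.1, h.2.1 rfl, h.2 rfl]
      refine D.cliqueFree (insert x (C.erase u)) ⟨?_, ?_⟩
      · rw [Finset.coe_insert]
        refine IsClique.insert (fun a ha b hb hab => ?_) fun b _ hb => hx b hb
        rw [Finset.coe_erase] at ha hb
        exact hoff a b ha.2 hb.2 (hC.isClique ha.1 hb.1 hab)
      · rw [Finset.card_insert_of_notMem (by simp [hxC]), Finset.card_erase_of_mem hu, hC.card_eq]
        have := D.three_le_t
        omega
    · refine D.cliqueFree C ⟨fun a ha b hb hab => ?_, hC.card_eq⟩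
      exact hoff a b (fun h => hu (h ▸ ha)) (fun h => hu (h ▸ hb)) (hC.isClique ha hb hab)
  · intro v
    by_cases hv : v = u ∨ v = x
    · refine lt_of_le_of_lt (Set.ncard_le_ncard (t := {u, x}) ?_ (Set.toFinite _))
        ((Set.ncard_insert_le _ _).trans_lt ?_)
      · intro w hw
        simp only [f', if_pos hv, Set.mem_ofPred_eq] at hw
        split_ifs at hw with h
        exact h
      · rw [Set.ncard_singleton]
        omega
    · refine lt_of_le_of_lt (Set.ncard_le_ncard ?_ (Set.toFinite _)) (D.ncard_fiber_lt v)
      intro w hw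
      simp only [f', if_neg hv, Set.mem_ofPred_eq] at hw
      split_ifs at hw with h
      simpa using hw
  · intro a b hab
    have habne := hab.ne
    by_cases hau : a = u
    · by_cases hbx : b = x
      · right; simp [f', hau, hbx]
      · exact .inl ((hadj a b).2 ⟨habne, .inl (.inr ⟨hau, hbx⟩)⟩)
    by_cases hbu : b = u
    · by_cases hax : a = x
      · right; simp [f', hax, hbu]
      · exact .inl ((hadj a b).2 ⟨habne, .inr (.inr ⟨hbu, hax⟩)⟩)
    by_cases hR : R.Adj a b
    · exact .inl ((hadj a b).2 ⟨habne, .inl (.inl ⟨hR, hau, hbu⟩)⟩)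
    right
    have hax : a ≠ x := by
      rintro rfl
      exact hR (hx b habne)
    have hbx : b ≠ x := by
      rintro rfl
      exact hR (hx a habne.symm).symm
    have hB := ((D.adj_iff a b).1 hab).resolve_left hR
    simp [f', hau, hbu, hax, hbx, (D.eq_iff_reachable a b).2 hB.reachable]

theorem degree_add_two_le (x : V) : R.degree x + 2 ≤ Fintype.card V := by
  obtain ⟨y, hxy, hy⟩ := D.exists_not_red x
  have hsub : R.neighborFinset x ⊆ Finset.univ \ {x, y} := by
    intro z hz
    rw [mem_neighborFinset] at hz
    simp only [Finset.mem_sdiff, Finset.mem_univ, true_and, Finset.mem_insert,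
      Finset.mem_singleton, not_or]
    exact ⟨hz.ne', fun h => hy (h ▸ hz)⟩
  have := Finset.card_le_card hsub
  rw [card_neighborFinset_eq_degree, Finset.card_sdiff_of_subset (Finset.subset_univ _),
    Finset.card_pair hxy, Finset.card_univ] at this
  have h2 : ({x, y} : Finset V).card ≤ Fintype.card V := Finset.card_le_univ _
  rw [Finset.card_pair hxy] at h2
  omega

theorem two_mul_le_degree (x : V) : 2 * (t - 2) ≤ R.degree x := by
  have := two_mul_le_card_neighbors_of_saturated (by have := D.three_le_t; omega) D.cliqueFree
    D.saturated D.exists_not_red x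
  rwa [← card_neighborFinset_eq_degree, neighborFinset_eq_filter]

/-- Every `K_t` created by `uw` contains the edge `wv`, so the component of `w` and the singleton
`{v}` have at least `k` vertices together. -/
theorem ncard_eq_of_forall_mem {u v w : V}
    (h : ∀ S : Finset V, H.IsNClique (t - 2) S → (S : Set V) ⊆ H.neighborSet u → v ∈ S)
    (hv : ∀ z, f z = f v → z = v) (huw : f u ≠ f w) (hnw : ¬ H.Adj u w) :
    {z | f z = f w}.ncard = k - 1 := by
  have hmem : ∀ S : Finset V, H.IsNClique (t - 2) S → (S : Set V) ⊆ H.commonNeighbors u w →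
      v ∈ S := fun S hS hSc => h S hS fun s hs => (hSc hs).1
  obtain ⟨S, hS, hSc⟩ := D.exists_common_clique huw hnw
  have hwv : H.Adj w v := (hSc (hmem S hS hSc)).2
  have hle := D.le_add_of_forall_mem huw hnw hwv.ne hwv fun C hC => by
    have hne : u ≠ w := fun h => huw (h ▸ rfl)
    have hwC : w ∈ C := D.cross_cliqueFree.mem_of_sup_edge_isNClique (edge_comm u w ▸ hC)
    obtain ⟨S, hS, hSc, hSC⟩ := exists_isNClique_subset_commonNeighbors D.cross_cliqueFree hne hC
    exact ⟨hwC, hSC (hmem S hS hSc)⟩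
  have h1 : {z | f z = f v} = {v} := by
    ext z
    exact ⟨hv z, fun h => h ▸ rfl⟩
  rw [h1, Set.ncard_singleton] at hle
  have := D.ncard_fiber_lt w
  omega

/-- For a vertex `u` of minimum degree there is a missing edge such that every `K_t` created by it
contains a `K_{t-2}` in the neighborhood of `u`. -/
theorem exists_not_adj_forall_exists_subset {u : V} (hu : ∀ v, H.degree u ≤ H.degree v) :
    ∃ a b, f a ≠ f b ∧ ¬ H.Adj a b ∧ ∀ C : Finset V, (H ⊔ edge a b).IsNClique t C →
      ∃ S ⊆ C, H.IsNClique (t - 2) S ∧ (S : Set V) ⊆ H.neighborSet u := by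
  by_cases hw : ∃ w, f u ≠ f w ∧ ¬ H.Adj u w
  · obtain ⟨w, huw, hnw⟩ := hw
    refine ⟨u, w, huw, hnw, fun C hC => ?_⟩
    obtain ⟨S, hS, hSc, hSC⟩ := exists_isNClique_subset_commonNeighbors D.cross_cliqueFree
      (ne_of_apply_ne f huw) hC
    exact ⟨S, hSC, hS, fun s hs => (hSc hs).1⟩
  push Not at hw
  -- Otherwise `u` is joined to everything outside its class, and by minimality of its degree so is
  -- every vertex of the class. A missing edge `ab` then avoids the class. A `K_t` created by it has
  -- at most one vertex in the class; dropping that one and `b` leaves a `K_{t-2}` joined to `u`.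
  have hcomplete : ∀ a b, f a = f u → f b ≠ f u → H.Adj a b := by
    intro a b ha hb
    have hsub : H.neighborFinset a ⊆ H.neighborFinset u := by
      intro z hz
      rw [mem_neighborFinset] at hz ⊢
      exact hw z (ha ▸ D.ne_of_cross hz)
    have heq := Finset.eq_of_subset_of_card_le hsub (hu a)
    rw [← mem_neighborFinset, heq, mem_neighborFinset]
    exact hw b hb.symm
  obtain ⟨a, b, hab, hn⟩ := D.exists_not_adj
  have hfab : f a ≠ f b := fun h => hn (D.adj_of_eq h hab)
  have hnH : ¬ H.Adj a b := fun h => hn ((D.cross_adj_iff a b).1 h).1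
  have ha : f a ≠ f u := fun h => hnH (hcomplete a b h (h ▸ hfab.symm))
  have hb : f b ≠ f u := fun h => hnH (hcomplete b a h (h ▸ hfab)).symm
  refine ⟨a, b, hfab, hnH, fun C hC => ?_⟩
  have hbC : b ∈ C := D.cross_cliqueFree.mem_of_sup_edge_isNClique (edge_comm a b ▸ hC)
  have hedge : ∀ x ∈ C, ∀ y ∈ C, x ≠ b → y ≠ b → x ≠ y → H.Adj x y := by
    intro x hx y hy hxb hyb hxy
    have := hC.isClique hx hy hxy
    rw [sup_adj, edge_adj] at this
    rcases this with h | ⟨⟨-, h⟩ | ⟨h, -⟩, -⟩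
    exacts [h, absurd h hyb, absurd h hxb]
  have hone : {x ∈ C | f x = f u}.card ≤ 1 := by
    refine Finset.card_le_one.2 fun x hx y hy => ?_
    rw [Finset.mem_filter] at hx hy
    by_contra hxy
    refine D.ne_of_cross (hedge x hx.1 y hy.1 ?_ ?_ hxy) (hx.2.trans hy.2.symm)
    · rintro rfl; exact hb hx.2
    · rintro rfl; exact hb hy.2
  have hsum := Finset.card_filter_add_card_filter_not (s := C) (fun x => f x = f u)
  have hbmem : b ∈ {x ∈ C | ¬ f x = f u} := Finset.mem_filter.2 ⟨hbC, hb⟩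
  obtain ⟨S, hSsub, hScard⟩ := Finset.exists_subset_card_eq (n := t - 2)
    (s := {x ∈ C | ¬ f x = f u}.erase b) (by
      rw [Finset.card_erase_of_mem hbmem]
      have := hC.card_eq
      omega)
  have hS : ∀ x ∈ S, x ≠ b ∧ x ∈ C ∧ f x ≠ f u := fun x hx => by
    simpa using hSsub hx
  refine ⟨S, fun x hx => (hS x hx).2.1, ⟨fun x hx y hy hxy => ?_, hScard⟩, fun x hx => ?_⟩
  · exact hedge x (hS x hx).2.1 y (hS y hy).2.1 (hS x hx).1 (hS y hy).1 hxy
  · exact hw x (hS x hx).2.2.symm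

theorem exists_isNClique_subset_neighborSet {u : V} (hu : ∀ v, H.degree u ≤ H.degree v) :
    ∃ S : Finset V, H.IsNClique (t - 2) S ∧ (S : Set V) ⊆ H.neighborSet u := by
  obtain ⟨a, b, hab, hn, h⟩ := D.exists_not_adj_forall_exists_subset hu
  obtain ⟨C, hC⟩ := D.exists_isNClique_sup_edge hab hn
  obtain ⟨S, -, hS⟩ := h C hC
  exact ⟨S, hS⟩

/-- The classes of `x` and `y` have at least `k ≥ t` vertices together and lie in the neighborhood
of `u`: a non-neighbor of `u` in the class of `x` would be adjacent to `x`, which belongs to their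
common `K_{t-2}`. The other `t - 4` vertices of a `K_{t-2}` raise the degree to at least `2t - 4`.
-/
theorem lt_degree_of_forall_mem {u x y : V} (hu : ∀ v, H.degree u ≤ H.degree v) (htk : t ≤ k)
    (hux : H.Adj u x) (huy : H.Adj u y) (hxy : H.Adj x y)
    (h : ∀ S : Finset V, H.IsNClique (t - 2) S → (S : Set V) ⊆ H.neighborSet u →
      x ∈ S ∧ y ∈ S) : 2 * t - 5 < H.degree u := by
  obtain ⟨a, b, hab, hn, hC⟩ := D.exists_not_adj_forall_exists_subset hu
  have hk := D.le_add_of_forall_mem hab hn hxy.ne hxy fun C hCt => by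
    obtain ⟨S, hSC, hS, hSu⟩ := hC C hCt
    exact ⟨hSC (h S hS hSu).1, hSC (h S hS hSu).2⟩
  have hclass : ∀ z, H.Adj u z → (∀ S : Finset V, H.IsNClique (t - 2) S →
      (S : Set V) ⊆ H.neighborSet u → z ∈ S) → ∀ w, f w = f z → H.Adj u w := by
    intro z huz hz w hwz
    by_contra hnw
    obtain ⟨S, hS, hSc⟩ := D.exists_common_clique (hwz ▸ D.ne_of_cross huz) hnw
    exact D.ne_of_cross (hSc (hz S hS fun s hs => (hSc hs).1)).2 hwz
  have hDx := hclass x hux fun S hS hSu => (h S hS hSu).1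
  have hDy := hclass y huy fun S hS hSu => (h S hS hSu).2
  obtain ⟨S, hS, hSu⟩ := D.exists_isNClique_subset_neighborSet hu
  set X : Finset V := {w | f w = f x}
  set Y : Finset V := {w | f w = f y}
  have hX : {w | f w = f x}.ncard = X.card := by
    rw [Set.ncard_eq_toFinset_card', Set.toFinset_ofPred]
  have hY : {w | f w = f y}.ncard = Y.card := by
    rw [Set.ncard_eq_toFinset_card', Set.toFinset_ofPred]
  have hXY : Disjoint X Y := by
    rw [Finset.disjoint_left]
    intro z hzx hzy
    simp only [X, Y, Finset.mem_filter, Finset.mem_univ, true_and] at hzx hzy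
    exact D.ne_of_cross hxy (hzx.symm.trans hzy)
  have hSxy := h S hS hSu
  have hdisj : Disjoint (X ∪ Y) ((S.erase x).erase y) := by
    rw [Finset.disjoint_left]
    intro z hz hzS
    simp only [X, Y, Finset.mem_union, Finset.mem_filter, Finset.mem_univ, true_and,
      Finset.mem_erase] at hz hzS
    rcases hz with hz | hz
    · exact D.ne_of_cross (hS.isClique hzS.2.2 hSxy.1 hzS.2.1) hz
    · exact D.ne_of_cross (hS.isClique hzS.2.2 hSxy.2 hzS.1) hz
  have hsub : (X ∪ Y) ∪ ((S.erase x).erase y) ⊆ H.neighborFinset u := by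
    intro z hz
    simp only [X, Y, Finset.mem_union, Finset.mem_filter, Finset.mem_univ, true_and,
      Finset.mem_erase] at hz
    rw [mem_neighborFinset]
    rcases hz with (hz | hz) | hz
    exacts [hDx z hz, hDy z hz, hSu hz.2.2]
  have hcard := Finset.card_le_card hsub
  rw [Finset.card_union_of_disjoint hdisj, Finset.card_union_of_disjoint hXY,
    Finset.card_erase_of_mem (Finset.mem_erase.2 ⟨hxy.ne', hSxy.2⟩),
    Finset.card_erase_of_mem hSxy.1, hS.card_eq, card_neighborFinset_eq_degree] at hcard
  have hS2 : 2 ≤ S.card := by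
    rw [← Finset.card_pair hxy.ne]
    exact Finset.card_le_card (by
      intro z hz
      rcases Finset.mem_insert.1 hz with rfl | hz
      exacts [hSxy.1, Finset.mem_singleton.1 hz ▸ hSxy.2])
  rw [hS.card_eq] at hS2
  omega

/-- The red degree is at least `2(t - 2)`. If `u` has a blue neighbor `b`, at most `k - 3` red edges
stay in its class, which contains `u` and `b`; otherwise its class is a singleton and all red edges
are cross edges. -/
theorem two_mul_le_add_degree (u : V) : 2 * t - 1 ≤ k + H.degree u := by
  have ht := D.three_le_t
  have hk := D.three_le_k
  have h1 := D.two_mul_le_degree u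
  by_cases hb : ∃ b, B.Adj u b
  · obtain ⟨b, hb⟩ := hb
    set F : Finset V := {w | f w = f u}
    have hF : F.card < k := by
      have := D.ncard_fiber_lt u
      rwa [Set.ncard_eq_toFinset_card', Set.toFinset_ofPred] at this
    have hsub : R.neighborFinset u ⊆ H.neighborFinset u ∪ (F.erase u).erase b := by
      intro w hw
      simp only [F, Finset.mem_union, mem_neighborFinset, Finset.mem_erase, Finset.mem_filter,
        Finset.mem_univ, true_and] at hw ⊢
      refine (D.cross_or_eq ((D.adj_iff u w).2 (.inl hw))).imp_right fun h => ?_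
      exact ⟨fun hwb => D.not_red_of_blue u b hb (hwb ▸ hw), hw.ne', h.symm⟩
    have huF : u ∈ F := by simp [F]
    have hbF : b ∈ F.erase u := by
      simp [F, hb.ne', (D.eq_iff_reachable u b).2 hb.reachable]
    have h2 := (Finset.card_le_card hsub).trans (Finset.card_union_le _ _)
    have h3 := Finset.card_pos.2 ⟨b, hbF⟩
    rw [Finset.card_erase_of_mem hbF, card_neighborFinset_eq_degree,
      card_neighborFinset_eq_degree] at h2
    rw [Finset.card_erase_of_mem huF] at h2 h3
    omega
  · have hsub : R.neighborFinset u ⊆ H.neighborFinset u := by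
      intro w hw
      rw [mem_neighborFinset] at hw ⊢
      refine (D.cross_or_eq ((D.adj_iff u w).2 (.inl hw))).resolve_right fun h => ?_
      obtain ⟨p⟩ := (D.eq_iff_reachable u w).1 h
      cases p with
      | nil => exact hw.ne rfl
      | cons h _ => exact hb ⟨_, h⟩
    have h2 := Finset.card_le_card hsub
    rw [card_neighborFinset_eq_degree, card_neighborFinset_eq_degree] at h2
    omega

end CriticalData

end Structure
end CoCritical

namespace CoCritical

open SimpleGraph

/-! ### Minimum degree and connectivity of the cross graph -/

section Structure

open scoped Classical

variable {V : Type*} [Fintype V] {t k : ℕ} {G R B H : SimpleGraph V} {α : Type*} {f : V → α}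

omit [Fintype V] in
theorem not_adj_of_cliqueFree_three {R : SimpleGraph V} (hR : R.CliqueFree 3) {a b c : V}
    (hab : R.Adj a b) (hac : R.Adj a c) : ¬ R.Adj b c := fun hbc =>
  hR {a, b, c} (is3Clique_triple_iff.2 ⟨hab, hac, hbc⟩)

namespace CriticalData

variable (D : CriticalData t k G R B H f)
include D

theorem exists_common_neighbor_cross (ht : t = 3) {u v : V} (hf : f u ≠ f v) (h : ¬ H.Adj u v) :
    ∃ c, H.Adj u c ∧ H.Adj v c := by
  obtain ⟨S, hS, hSc⟩ := D.exists_common_clique hf h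
  obtain ⟨c, rfl⟩ := (Finset.card_eq_one (s := S)).1 (by rw [hS.card_eq, ht])
  exact ⟨c, hSc (by simp)⟩

/-- If `v` is the only neighbor of `u`, the red graph turns out complete bipartite with side `P`
containing `v`. As `v` is not red to all vertices, `P` meets the blue component of `u`, and a blue
path from `u` would have to cross between the sides on a red edge. -/
theorem degree_ne_one_of_eq_three (ht : t = 3) {u : V} (hu : ∀ v, H.degree u ≤ H.degree v) :
    H.degree u ≠ 1 := by
  intro hdeg
  obtain ⟨v, hv⟩ := Finset.card_eq_one.1 ((card_neighborFinset_eq_degree H u).trans hdeg)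
  have hNu : ∀ w, H.Adj u w ↔ w = v := by
    intro w
    rw [← mem_neighborFinset, hv, Finset.mem_singleton]
  have hNe : ∀ w, ∃ z, H.Adj w z := by
    intro w
    have := hu w
    rw [hdeg, ← card_neighborFinset_eq_degree] at this
    obtain ⟨z, hz⟩ := Finset.card_pos.1 (Nat.lt_of_succ_le this)
    exact ⟨z, (mem_neighborFinset _ _ _).1 hz⟩
  have hR3 : R.CliqueFree 3 := ht ▸ D.cliqueFree
  have huv : H.Adj u v := (hNu v).2 rfl
  have hfuv := D.ne_of_cross huv
  let P : V → Prop := fun z => z = v ∨ (f z = f u ∧ ¬ H.Adj v z)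
  have hvQ : ∀ z, ¬ P z → H.Adj v z := by
    intro z hz
    by_contra hvz
    simp only [P, not_or, not_and, not_not] at hz
    have hfz : f u ≠ f z := fun h => hvz (hz.2 h.symm)
    obtain ⟨c, huc, hzc⟩ := D.exists_common_neighbor_cross ht hfz
      (fun h => hz.1 ((hNu z).1 h))
    rw [hNu] at huc
    exact hvz (huc ▸ hzc.symm)
  have hPP : ∀ a b, P a → P b → ¬ R.Adj a b := by
    have hvM : ∀ b, f b = f u → ¬ H.Adj v b → ¬ R.Adj v b := fun b hb hvb hR =>
      D.not_adj_of_not_cross (fun h => hfuv (hb ▸ h.symm)) hvb ((D.adj_iff _ _).2 (.inl hR))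
    rintro a b (rfl | ⟨ha, hva⟩) (rfl | ⟨hb, hvb⟩) hab
    · exact hab.ne rfl
    · exact hvM b hb hvb hab
    · exact hvM a ha hva hab.symm
    · obtain ⟨w, haw⟩ := hNe a
      have hwv : w ≠ v := by
        rintro rfl
        exact hva haw.symm
      have hfw : f w ≠ f u := fun h => D.ne_of_cross haw (ha.trans h.symm)
      have hvw : H.Adj v w := hvQ w (by simp [P, hwv, hfw])
      -- Otherwise a common neighbor `z` of `b` and `w` would form a red triangle with `v` and `w`.
      have hbw : H.Adj b w := by
        by_contra hbw
        obtain ⟨z, hbz, hwz⟩ := D.exists_common_neighbor_cross ht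
          (fun h => hfw (h.symm.trans hb)) hbw
        have hzv : z ≠ v := by
          rintro rfl
          exact hvb hbz.symm
        have hfz : f z ≠ f u := fun h => D.ne_of_cross hbz (hb.trans h.symm)
        have hvz : H.Adj v z := hvQ z (by simp [P, hzv, hfz])
        exact not_adj_of_cliqueFree_three hR3 (D.red_of_cross hvw) (D.red_of_cross hvz)
          (D.red_of_cross hwz)
      exact not_adj_of_cliqueFree_three hR3 hab (D.red_of_cross haw) (D.red_of_cross hbw)
  have hQQ : ∀ a b, ¬ P a → ¬ P b → ¬ R.Adj a b := fun a b ha hb =>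
    not_adj_of_cliqueFree_three hR3 (D.red_of_cross (hvQ a ha)) (D.red_of_cross (hvQ b hb))
  have hQP : ∀ a b, ¬ P a → P b → R.Adj a b := by
    intro a b ha hb
    by_contra hab
    obtain ⟨S, hS, hSc⟩ := D.saturated a b (fun h => ha (h ▸ hb)) hab
    obtain ⟨c, rfl⟩ := (Finset.card_eq_one (s := S)).1 (by rw [hS.card_eq, ht])
    obtain ⟨hac, hbc⟩ := hSc (Finset.mem_coe.2 (Finset.mem_singleton_self c))
    by_cases hc : P c
    exacts [hPP b c hb hc hbc, hQQ a c ha hc hac]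
  obtain ⟨m, hvm, hm⟩ := D.exists_not_red v
  have hPm : P m := by
    by_contra h
    exact hm (D.red_of_cross (hvQ m h))
  have hPu : ¬ P u := by
    rintro (h | h)
    exacts [huv.ne h, h.2 huv.symm]
  have hfm : f u = f m := (hPm.resolve_left hvm.symm).1.symm
  obtain ⟨p⟩ := (D.eq_iff_reachable u m).1 hfm
  obtain ⟨d, -, hd1, hd2⟩ := p.exists_boundary_dart {z | ¬ P z} hPu (by simpa using hPm)
  exact D.not_red_of_blue _ _ d.adj (hQP _ _ hd1 (by simpa using hd2))

theorem sub_one_le_degree {u : V} (hu : ∀ v, H.degree u ≤ H.degree v) : t - 1 ≤ H.degree u := by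
  have ht := D.three_le_t
  by_contra! hlt
  have hsum := D.two_mul_le_add_degree u
  obtain ⟨S, hS, hSu⟩ := D.exists_isNClique_subset_neighborSet hu
  have hsub : ∀ S : Finset V, (S : Set V) ⊆ H.neighborSet u → S ⊆ H.neighborFinset u :=
    fun S hSu z hz => (mem_neighborFinset _ _ _).2 (hSu hz)
  have hle := Finset.card_le_card (hsub S hSu)
  rw [hS.card_eq, card_neighborFinset_eq_degree] at hle
  have hall : ∀ S : Finset V, H.IsNClique (t - 2) S → (S : Set V) ⊆ H.neighborSet u →
      S = H.neighborFinset u := fun S hS hSu =>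
    Finset.eq_of_subset_of_card_le (hsub S hSu) (by
      rw [hS.card_eq, card_neighborFinset_eq_degree]
      omega)
  by_cases h3 : t = 3
  · exact D.degree_ne_one_of_eq_three h3 hu (by omega)
  obtain ⟨x, hx, y, hy, hxy⟩ := Finset.one_lt_card.1 (show 1 < S.card by rw [hS.card_eq]; omega)
  -- The hypothesis `t ≤ k` holds since `2t - 1 ≤ k + δ(H)` and `δ(H) ≤ t - 2`.
  have := D.lt_degree_of_forall_mem hu (by omega) (hSu hx) (hSu hy) (hS.isClique hx hy hxy)
    fun S' hS' hS'u => by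
      rw [hall S' hS' hS'u, ← hall S hS hSu]
      exact ⟨hx, hy⟩
  omega

theorem cross_connected : H.Connected := by
  have ht := D.three_le_t
  have := D.nonempty
  have hreach : ∀ a b, f a ≠ f b → H.Reachable a b := by
    intro a b hab
    by_cases h : H.Adj a b
    · exact h.reachable
    obtain ⟨S, hS, hSc⟩ := D.exists_common_clique hab h
    obtain ⟨c, hc⟩ := Finset.card_pos.1 (show 0 < S.card by rw [hS.card_eq]; omega)
    exact (hSc hc).1.reachable.trans (hSc hc).2.symm.reachable
  obtain ⟨u, hu⟩ := H.exists_minimal_degree_vertex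
  have hmin : ∀ v, H.degree u ≤ H.degree v := fun v => hu ▸ H.minDegree_le_degree v
  have hdeg := D.sub_one_le_degree hmin
  refine ⟨fun a b => ?_⟩
  by_cases hab : f a = f b
  · have := hmin a
    rw [← card_neighborFinset_eq_degree H a] at this
    obtain ⟨w, hw⟩ := Finset.card_pos.1 (show 0 < (H.neighborFinset a).card by omega)
    rw [mem_neighborFinset] at hw
    exact hw.reachable.trans (hreach w b (hab ▸ (D.ne_of_cross hw).symm))
  · exact hreach a b hab

end CriticalData

/-! ### Counting edges inside the components -/

section Counting

/-- The number of vertices `v` with `f v = a`. -/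
noncomputable def fiberCard (f : V → α) (a : α) : ℕ := (Finset.univ.filter fun v => f v = a).card

theorem ncard_fiber_eq (f : V → α) (a : α) : {w | f w = a}.ncard = fiberCard f a := by
  rw [Set.ncard_eq_toFinset_card', Set.toFinset_ofPred, fiberCard]

variable [Fintype α] (D : CriticalData t k G R B H f) (hf : Function.Surjective f)
include D hf

/-- Two components with fewer than `r` vertices have at most `2 * r - 2 < k` together, so
representatives of the small components form a clique of `H`. -/
theorem CriticalData.card_small_lt {r : ℕ} (hr : 2 * r ≤ k + 1) :
    (Finset.univ.filter fun a => fiberCard f a < r).card < t := by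
  obtain ⟨g, hg⟩ := hf.hasRightInverse
  have hginj : Function.Injective g := hg.injective
  rw [← Finset.card_image_of_injective _ hginj]
  refine card_lt_of_isClique_of_cliqueFree D.cross_cliqueFree ?_
  intro x hx y hy hxy
  simp only [Finset.coe_image, Set.mem_image, Finset.coe_filter, Finset.mem_univ, true_and,
    Set.mem_ofPred_eq] at hx hy
  obtain ⟨a, ha, rfl⟩ := hx
  obtain ⟨b, hb, rfl⟩ := hy
  refine D.cross_adj_of_add_lt (fun h => hxy ?_) ?_
  · rw [hg, hg] at h
    rw [h]
  · rw [ncard_fiber_eq, ncard_fiber_eq, hg, hg]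
    omega

theorem CriticalData.sum_fiberCard_bound {r : ℕ} (hr2 : 2 ≤ r) (hr : 2 * r ≤ k + 1)
    (hkr : k ≤ 2 * r) :
    ((r : ℝ) - 1) * ((Fintype.card V : ℝ) - ((t : ℝ) - 1) * ((r : ℝ) - 1)) ≤
        ∑ a, (fiberCard f a : ℝ) * ((fiberCard f a : ℝ) - 1) ∧
      (4 ≤ k → ((r : ℝ) - 1) * ((Fintype.card V : ℝ) - ((t : ℝ) - 1) * ((r : ℝ) - 1)) <
        ∑ a, (fiberCard f a : ℝ) * ((fiberCard f a : ℝ) - 1)) := by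
  set s : α → ℝ := fun a => (fiberCard f a : ℝ) with hs
  set ρ : ℝ := (r : ℝ) - 1 with hρ
  have hρ1 : 1 ≤ ρ := by
    have : (2 : ℝ) ≤ r := by exact_mod_cast hr2
    linarith
  set S : Finset α := Finset.univ.filter fun a => fiberCard f a < r with hS
  have hs1 : ∀ a, 1 ≤ s a := by
    intro a
    obtain ⟨v, hv⟩ := hf a
    have : 0 < fiberCard f a := Finset.card_pos.2 ⟨v, by simp [hv]⟩
    exact Nat.one_le_cast.2 this
  have hsum : ∑ a, s a = (Fintype.card V : ℝ) := by
    simp only [hs, fiberCard]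
    rw [← Nat.cast_sum, ← Finset.card_eq_sum_card_fiberwise fun v _ => Finset.mem_coe.2
      (Finset.mem_univ (f v)), Finset.card_univ]
  have hSs : ∀ a ∈ S, s a ≤ ρ := by
    intro a ha
    have h : fiberCard f a + 1 ≤ r := (Finset.mem_filter.1 ha).2
    have : ((fiberCard f a + 1 : ℕ) : ℝ) ≤ r := by exact_mod_cast h
    push_cast at this
    simp only [hs, hρ]
    linarith
  have hLs : ∀ a ∈ Sᶜ, ρ + 1 ≤ s a := by
    intro a ha
    have h : r ≤ fiberCard f a := by simpa [hS] using ha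
    have : (r : ℝ) ≤ fiberCard f a := by exact_mod_cast h
    simp only [hs, hρ]
    linarith
  have hScard : (S.card : ℝ) + 1 ≤ t := by
    exact_mod_cast D.card_small_lt hf hr
  have ht : (3 : ℝ) ≤ t := by exact_mod_cast D.three_le_t
  have hsplit : ∀ g : α → ℝ, ∑ a, g a = ∑ a ∈ S, g a + ∑ a ∈ Sᶜ, g a := fun g =>
    (Finset.sum_add_sum_compl S g).symm
  -- The difference of the two sides is a sum of four nonnegative terms, so equality forces each to
  -- vanish.
  have hid : ∑ a, s a * (s a - 1) - ρ * ((Fintype.card V : ℝ) - ((t : ℝ) - 1) * ρ) =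
      ∑ a ∈ Sᶜ, s a * (s a - 1 - ρ) + ∑ a ∈ S, s a * (s a - 1) + ρ * ∑ a ∈ S, (ρ - s a) +
        ρ * ρ * ((t : ℝ) - 1 - S.card) := by
    have e1 : ∑ a ∈ Sᶜ, s a * (s a - 1 - ρ) = ∑ a ∈ Sᶜ, s a * (s a - 1) - ρ * ∑ a ∈ Sᶜ, s a := by
      rw [Finset.mul_sum, ← Finset.sum_sub_distrib]
      exact Finset.sum_congr rfl fun a _ => by ring
    rw [e1, ← hsum, hsplit, hsplit s, Finset.sum_sub_distrib, Finset.sum_const, nsmul_eq_mul]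
    ring
  have h1 : ∀ a ∈ Sᶜ, 0 ≤ s a * (s a - 1 - ρ) := fun a ha =>
    mul_nonneg (by linarith [hs1 a]) (by linarith [hLs a ha])
  have h2 : ∀ a ∈ S, 0 ≤ s a * (s a - 1) := fun a _ =>
    mul_nonneg (by linarith [hs1 a]) (by linarith [hs1 a])
  have h3 : ∀ a ∈ S, 0 ≤ ρ - s a := fun a ha => by linarith [hSs a ha]
  have n1 := Finset.sum_nonneg h1
  have n2 := Finset.sum_nonneg h2
  have n3 := mul_nonneg (show 0 ≤ ρ by linarith) (Finset.sum_nonneg h3)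
  have n4 : 0 ≤ ρ * ρ * ((t : ℝ) - 1 - S.card) :=
    mul_nonneg (mul_nonneg (by linarith) (by linarith)) (by linarith)
  refine ⟨by linarith, fun hk4 => lt_of_not_ge fun hge => ?_⟩
  have z1 := (Finset.sum_eq_zero_iff_of_nonneg h1).1 (by linarith)
  have z2 := (Finset.sum_eq_zero_iff_of_nonneg h2).1 (by linarith)
  have z3' : ρ * ∑ a ∈ S, (ρ - s a) = 0 := by linarith
  have z3 := (Finset.sum_eq_zero_iff_of_nonneg h3).1
    ((mul_eq_zero.1 z3').resolve_left (by linarith))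
  have z4' : ρ * ρ * ((t : ℝ) - 1 - S.card) = 0 := by linarith
  have z4 := (mul_eq_zero.1 z4').resolve_left (mul_ne_zero (by linarith) (by linarith))
  obtain ⟨a, ha⟩ : S.Nonempty := by
    rw [← Finset.card_pos]
    have : (0 : ℝ) < S.card := by linarith
    exact_mod_cast this
  -- Equality forces `r = 2`, a singleton component and all components of size at most two. For `k ≥
  -- 4` the singleton is then joined in red to every other vertex, which is excluded.
  have hsa : s a = 1 := by
    have := (mul_eq_zero.1 (z2 a ha)).resolve_left (by linarith [hs1 a])
    linarith
  have hρeq : ρ = 1 := by linarith [z3 a ha]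
  have hr' : r = 2 := by
    have : (r : ℝ) = 2 := by linarith
    exact_mod_cast this
  have hsmall : ∀ b, fiberCard f b ≤ 2 := by
    intro b
    have : (fiberCard f b : ℝ) ≤ 2 := by
      change s b ≤ 2
      by_cases hb : b ∈ S
      · linarith [hSs b hb]
      · have := (mul_eq_zero.1 (z1 b (Finset.mem_compl.2 hb))).resolve_left
          (by linarith [hs1 b])
        linarith
    exact_mod_cast this
  have hfa : fiberCard f a = 1 := by
    have : (fiberCard f a : ℝ) = 1 := hsa
    exact_mod_cast this
  obtain ⟨v, hv⟩ := Finset.card_eq_one.1 hfa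
  have hmem : ∀ w, f w = a ↔ w = v := by
    intro w
    have := Finset.ext_iff.1 hv w
    simpa using this
  obtain ⟨w, hvw, hw⟩ := D.exists_not_red v
  have hfv : f v = a := (hmem v).2 rfl
  refine hw (D.red_of_cross (D.cross_adj_of_add_lt (fun h => ?_) ?_))
  · exact hvw ((hmem w).1 (h ▸ hfv)).symm
  · rw [ncard_fiber_eq, ncard_fiber_eq, hfv, hfa]
    have := hsmall (f w)
    omega

end Counting

end Structure

end CoCritical

/-! ### Assembly of the theorem -/

namespace CoCritical

open SimpleGraph

theorem natCeil_div_two (k : ℕ) : ⌈(k : ℝ) / 2⌉₊ = (k + 1) / 2 := by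
  have h := Nat.div_add_mod (k + 1) 2
  refine le_antisymm (Nat.ceil_le.2 ?_) (Nat.le_of_lt_succ ?_)
  · have : k ≤ 2 * ((k + 1) / 2) := by omega
    have : (k : ℝ) ≤ 2 * (((k + 1) / 2 : ℕ) : ℝ) := by exact_mod_cast this
    linarith
  · have h1 := Nat.le_ceil ((k : ℝ) / 2)
    have : (k : ℝ) ≤ 2 * (⌈(k : ℝ) / 2⌉₊ : ℝ) := by linarith
    have : k ≤ 2 * ⌈(k : ℝ) / 2⌉₊ := by exact_mod_cast this
    omega

open scoped Classical in
theorem CriticalData.ncard_edgeSet_induce {V : Type*} [Fintype V] {t k : ℕ}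
    {G R B H : SimpleGraph V}
    (D : CriticalData t k G R B H B.connectedComponentMk) (C : B.ConnectedComponent) :
    2 * ((G.induce C.supp).edgeSet.ncard : ℝ) =
      (fiberCard B.connectedComponentMk C : ℝ) *
        ((fiberCard B.connectedComponentMk C : ℝ) - 1) := by
  have htop : G.induce C.supp = ⊤ := by
    refine top_unique fun a b hab => ?_
    exact D.adj_of_eq (a.2.trans b.2.symm) fun h => hab (Subtype.ext h)
  have hcard : Fintype.card C.supp = fiberCard B.connectedComponentMk C := by
    rw [← ncard_fiber_eq, ← Nat.card_eq_fintype_card]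
    rfl
  rw [htop, ← coe_edgeFinset, Set.ncard_coe_finset, card_edgeFinset_top_eq_card_choose_two, hcard,
    Nat.cast_choose_two]
  ring

end CoCritical

open CoCritical in
open Classical in
theorem mainTheorem3 :
    ∃ c : ℕ → ℕ → ℝ,
      ∀ (t k : ℕ), 3 ≤ t → 3 ≤ k →
      ∀ (V : Type*) [Fintype V] (G : SimpleGraph V), IsCoCritical t k G →
      ∀ τ : G.EdgeLabeling Color, IsMaxRedCriticalColoring t k τ →
      ∀ H : SimpleGraph V, H = crossGraph τ →
        -- (a)
        ((redGraph τ).maxDegree + 2 ≤ Fintype.card V ∧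
          2 * (t - 2) ≤ (redGraph τ).minDegree) ∧
        -- (b)
        (∀ Di Dj : (blueGraph τ).ConnectedComponent, Di ≠ Dj →
          ∀ u ∈ Di.supp, ∀ v ∈ Dj.supp, ¬ H.Adj u v →
            ∃ S : Finset V, H.IsNClique (t - 2) S ∧ (S : Set V) ⊆ H.commonNeighbors u v) ∧
        -- (c)
        (∀ u v : V, H.Adj u v →
          (∀ S : Finset V, H.IsNClique (t - 2) S → (S : Set V) ⊆ H.neighborSet u → v ∈ S) →
          (∃ Dj : (blueGraph τ).ConnectedComponent, Dj.supp = {v}) →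
          ∀ Di : (blueGraph τ).ConnectedComponent,
            u ∉ Di.supp → (Di.supp \ H.neighborSet u).Nonempty → Di.supp.ncard = k - 1) ∧
        -- (d)
        (H.minDegree ≤ 2 * t - 5 → t ≤ k →
          ∀ u : V, H.degree u = H.minDegree →
            ∀ x ∈ H.neighborSet u, ∀ y ∈ H.neighborSet u, H.Adj x y →
              ¬ ∀ S : Finset V, H.IsNClique (t - 2) S → (S : Set V) ⊆ H.neighborSet u →
                x ∈ S ∧ y ∈ S) ∧
        -- (e)
        ((2 * (t : ℤ) - 1 - (H.minDegree : ℤ) ≤ (k : ℤ)) ∧ t - 1 ≤ H.minDegree) ∧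
        -- (f)
        ((1 / 2 * (⌈(k : ℝ) / 2⌉₊ : ℝ) - 1 / 2) *
              ((Fintype.card V : ℝ) - ((t : ℝ) - 1) * ((⌈(k : ℝ) / 2⌉₊ : ℝ) - 1)) ≤
            ∑ D : (blueGraph τ).ConnectedComponent, ((G.induce D.supp).edgeSet.ncard : ℝ)) ∧
        (4 ≤ k →
          (1 / 2 * (⌈(k : ℝ) / 2⌉₊ : ℝ) - 1 / 2) *
              ((Fintype.card V : ℝ) - ((t : ℝ) - 1) * ((⌈(k : ℝ) / 2⌉₊ : ℝ) - 1)) <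
            ∑ D : (blueGraph τ).ConnectedComponent, ((G.induce D.supp).edgeSet.ncard : ℝ)) ∧
        -- (g)
        H.Connected ∧
        -- (h)
        (∀ q : ℕ, t - 1 ≤ q → q ≤ H.minDegree →
          (q : ℝ) * (Fintype.card V : ℝ) - c q k ≤ (H.edgeSet.ncard : ℝ)) := by

  -- The deficit is measured in degree sums, so half of it would suffice.
  refine ⟨fun q k => deficitBound q k q, ?_⟩
  rintro t k ht hk V _ G hG τ hτ H rfl
  have D := hτ.criticalData ht hk hG
  have hV := D.nonempty
  obtain ⟨u₀, hu₀⟩ := (crossGraph τ).exists_minimal_degree_vertex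
  have hmin : ∀ u, (crossGraph τ).degree u = (crossGraph τ).minDegree →
      ∀ v, (crossGraph τ).degree u ≤ (crossGraph τ).degree v := fun u hu v =>
    hu ▸ (crossGraph τ).minDegree_le_degree v
  refine ⟨⟨?_, ?_⟩, ?_, ?_, ?_, ⟨?_, ?_⟩, ?_⟩
  · obtain ⟨x, hx⟩ := (redGraph τ).exists_maximal_degree_vertex
    rw [hx]
    exact D.degree_add_two_le x
  · exact (redGraph τ).le_minDegree_of_forall_le_degree _ D.two_mul_le_degree
  · rintro Di Dj hij u rfl v rfl huv
    exact D.exists_common_clique hij huv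
  · rintro u v - hS ⟨Dj, hDj⟩ Di hu ⟨w, hw, hnw⟩
    have hv : v ∈ Dj.supp := by rw [hDj]; rfl
    have hDi : (blueGraph τ).connectedComponentMk w = Di := hw
    have := D.ncard_eq_of_forall_mem hS (fun z hz => by
      have : z ∈ Dj.supp := hz.trans hv
      rwa [hDj] at this) (fun h => hu (h.trans hDi)) hnw
    rw [hDi] at this
    exact this
  · intro hdeg htk u hu x hx y hy hxy hS
    have := D.lt_degree_of_forall_mem (hmin u hu) htk hx hy hxy hS
    omega
  · have := D.two_mul_le_add_degree u₀
    omega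
  · rw [hu₀]
    exact D.sub_one_le_degree (hmin u₀ hu₀.symm)
  · have hf := D.sum_fiberCard_bound (r := (k + 1) / 2)
      (fun C => C.exists_rep) (by omega) (by omega) (by omega)
    have hsum : 2 * ∑ C : (blueGraph τ).ConnectedComponent,
        ((G.induce C.supp).edgeSet.ncard : ℝ) =
        ∑ C, (fiberCard (blueGraph τ).connectedComponentMk C : ℝ) *
          ((fiberCard (blueGraph τ).connectedComponentMk C : ℝ) - 1) := by
      rw [Finset.mul_sum]
      exact Finset.sum_congr rfl fun C _ => D.ncard_edgeSet_induce C
    rw [natCeil_div_two]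
    refine ⟨?_, fun hk4 => ?_, D.cross_connected, fun q _ hq => ?_⟩
    · linarith [hf.1]
    · linarith [hf.2 hk4]
    · have hday := two_mul_card_le_sum_degree_add (q := q) (by omega) D.cross_cliqueFree
        D.ncard_fiber_lt (fun u v huv h => D.exists_common_clique huv h)
        (fun v => hq.trans ((crossGraph τ).minDegree_le_degree v))
      rw [SimpleGraph.sum_degrees_eq_twice_card_edges, ← Set.ncard_coe_finset, SimpleGraph.coe_edgeFinset] at hday
      have hday' : 2 * (q : ℝ) * (Fintype.card V : ℝ) ≤
          2 * ((crossGraph τ).edgeSet.ncard : ℝ) + (deficitBound q k q : ℝ) := by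
        exact_mod_cast hday
      have : (0 : ℝ) ≤ deficitBound q k q := Nat.cast_nonneg _
      linarith
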